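/- For $n \ge 1$ let $\mathbf{B}^n$ be the open unit ball of $\mathbb{R}^n$, $\mathbb{S}^{n-1} = \partial \mathbf{B}^n$, and $r = \|x\|$. Let $W^{1,2}(\mathbf{B}^n,\mathbb{S}^{n-1})$ be the set of $u \in W^{1,2}(\mathbf{B}^n,\mathbb{R}^n)$ with $\|u\| = 1$ almost everywhere, and let $\mathcal{A}_n$ be the set of those $u \in W^{1,2}(\mathbf{B}^n,\mathbb{S}^{n-1})$ with $u(x) = x$ on $\mathbb{S}^{n-1}$ in the sense of traces, that is, with $u - \mathrm{id} \in W^{1,2}_0(\mathbf{B}^n,\mathbb{R}^n)$. Let $u_0(x) = x/\|x\|$. For every integer $n \ge 6$ there is $p_0 \in (n-3,\, n-2)$ such that, for every $p \in (p_0,\, n-2)$, the map $u_0$ belongs to $\mathcal{A}_n$ but does not minimize the functional $$\tilde E_p(u) = \int_{\mathbf{B}^n} r^{2-p}\,\|\nabla u\|^2\,dx \in [0,\infty], \qquad \|\nabla u\|^2 = \sum_{j=1}^n \Big\|\frac{\partial u}{\partial x_j}\Big\|^2,$$ on $\mathcal{A}_n$; that is, there is $u \in \mathcal{A}_n$ with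 $\tilde E_p(u) < \tilde E_p(u_0)$. -/

import Mathlib

open MeasureTheory Set Metric
open scoped ContDiff ENNReal

noncomputable section

namespace WeightedEnergy

/-- Euclidean space of dimension `n`. -/
abbrev E (n : ℕ) : Type := EuclideanSpace ℝ (Fin n)

/-- The open unit ball of `ℝⁿ`. -/
def unitBall (n : ℕ) : Set (E n) := ball 0 1

/-- The `j`-th classical partial derivative of a map on `ℝⁿ`. -/
def partialDeriv {n : ℕ} {F : Type*} [NormedAddCommGroup F] [NormedSpace ℝ F]
    (j : Fin n) (φ : E n → F) (x : E n) : F :=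
  fderiv ℝ φ x (EuclideanSpace.single j 1)

/-- `φ` is a smooth map with compact support contained in `Ω`. -/
structure IsTestFunction {n : ℕ} {F : Type*} [NormedAddCommGroup F] [NormedSpace ℝ F]
    (Ω : Set (E n)) (φ : E n → F) : Prop where
  smooth : ContDiff ℝ ∞ φ
  compact : HasCompactSupport φ
  support_subset : tsupport φ ⊆ Ω

/-- `G` is a weak gradient of `u` on `Ω`: the maps `u` and `G j` are locally integrable on `Ω`, and
`G j` is the `j`-th partial derivative of `u` in the sense of distributions on `Ω`. -/
structure IsWeakGradient {n : ℕ} (Ω : Set (E n)) (u : E n → E n) (G : Fin n → E n → E n) :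
    Prop where
  locallyIntegrable : LocallyIntegrableOn u Ω
  locallyIntegrable_grad : ∀ j, LocallyIntegrableOn (G j) Ω
  integral_eq : ∀ (j : Fin n) (φ : E n → ℝ), IsTestFunction Ω φ →
    ∫ x in Ω, partialDeriv j φ x • u x = - ∫ x in Ω, φ x • G j x

open Classical in
/-- The weak gradient of `u` on `Ω` (and `0` if there is none). By `IsWeakGradient.ae_eq` below it
does not depend on the choice, up to equality almost everywhere on `Ω`. -/
def weakGradient {n : ℕ} (Ω : Set (E n)) (u : E n → E n) : Fin n → E n → E n :=
  if h : ∃ G, IsWeakGradient Ω u G then h.choose else 0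

theorem IsWeakGradient.ae_eq {n : ℕ} {Ω : Set (E n)} (hΩ : IsOpen Ω) {u : E n → E n}
    {G G' : Fin n → E n → E n} (h : IsWeakGradient Ω u G) (h' : IsWeakGradient Ω u G')
    (j : Fin n) : ∀ᵐ x ∂(volume.restrict Ω), G j x = G' j x := by
  have key : ∀ᵐ x ∂(volume : Measure (E n)), x ∈ Ω → (G j - G' j) x = 0 := by
    refine hΩ.ae_eq_zero_of_integral_contDiff_smul_eq_zero
      ((h.locallyIntegrable_grad j).sub (h'.locallyIntegrable_grad j)) ?_
    intro φ hφ hc hs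
    have ht : IsTestFunction Ω φ := ⟨hφ, hc, hs⟩
    have e : ∫ x in Ω, φ x • G j x = ∫ x in Ω, φ x • G' j x :=
      neg_injective ((h.integral_eq j φ ht).symm.trans (h'.integral_eq j φ ht))
    have hi : ∀ g : E n → E n, LocallyIntegrableOn g Ω → IntegrableOn (fun x => φ x • g x) Ω := by
      intro g hg
      have h1 : IntegrableOn (fun x => φ x • g x) (tsupport φ) :=
        (hg.integrableOn_compact_subset hs hc).continuousOn_smul
          hφ.continuous.continuousOn hc
      have h2 : Integrable (fun x => φ x • g x) := by
        refine (integrableOn_iff_integrable_of_support_subset ?_).1 h1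
        intro x hx
        refine subset_tsupport φ ?_
        intro h0
        exact hx (by simp [h0])
      exact h2.integrableOn
    rw [← setIntegral_eq_integral_of_forall_compl_eq_zero (s := Ω)]
    · simp only [Pi.sub_apply, smul_sub]
      rw [integral_sub (hi _ (h.locallyIntegrable_grad j)) (hi _ (h'.locallyIntegrable_grad j)), e,
        sub_self]
    · intro x hx
      have : φ x = 0 := by
        by_contra h0
        exact hx (hs (subset_tsupport φ h0))
      simp [this]
  rw [ae_restrict_iff' hΩ.measurableSet]
  filter_upwards [key] with x hx hxΩ
  exact sub_eq_zero.1 (hx hxΩ)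

/-- The Sobolev space `W^{1,2}(Ω, ℝⁿ)`. -/
def MemW12 {n : ℕ} (Ω : Set (E n)) (u : E n → E n) : Prop :=
  MemLp u 2 (volume.restrict Ω) ∧
    ∃ G, IsWeakGradient Ω u G ∧ ∀ j, MemLp (G j) 2 (volume.restrict Ω)

/-- The space `W₀^{1,2}(Ω, ℝⁿ)`: the closure in `W^{1,2}(Ω, ℝⁿ)` of the smooth maps with compact
support in `Ω`. -/
def MemW12Zero {n : ℕ} (Ω : Set (E n)) (v : E n → E n) : Prop :=
  MemW12 Ω v ∧ ∀ ε : ℝ≥0∞, 0 < ε → ∃ φ : E n → E n, IsTestFunction Ω φ ∧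
    eLpNorm (fun x => v x - φ x) 2 (volume.restrict Ω) < ε ∧
    ∀ j, eLpNorm (fun x => weakGradient Ω v j x - partialDeriv j φ x) 2 (volume.restrict Ω) < ε

/-- The maps `u ∈ W^{1,2}(𝐁ⁿ, 𝕊ⁿ⁻¹)`, that is `u ∈ W^{1,2}(𝐁ⁿ, ℝⁿ)` with `‖u‖ = 1` almost
everywhere, that satisfy `u(x) = x` on `∂𝐁ⁿ = 𝕊ⁿ⁻¹` in the sense of traces, that is
`u - id ∈ W₀^{1,2}(𝐁ⁿ, ℝⁿ)`. -/
def admissibleMaps (n : ℕ) : Set (E n → E n) :=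
  {u | MemW12 (unitBall n) u ∧ (∀ᵐ x ∂(volume.restrict (unitBall n)), ‖u x‖ = 1) ∧
    MemW12Zero (unitBall n) (fun x => u x - x)}

/-- The weighted energy `∫_{𝐁ⁿ} r^α ‖∇u‖² dx ∈ [0, ∞]`, where `r = ‖x‖` and
`‖∇u‖² = ∑ j, ‖∂u/∂x_j‖²`. -/
def weightedEnergy (n : ℕ) (α : ℝ) (u : E n → E n) : ℝ≥0∞ :=
  ∫⁻ x in unitBall n,
    ENNReal.ofReal (‖x‖ ^ α * ∑ j, ‖weakGradient (unitBall n) u j x‖ ^ 2)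

/-- The map `x ↦ x / ‖x‖`. -/
def radialMap (n : ℕ) (x : E n) : E n := ‖x‖⁻¹ • x

end WeightedEnergy

end

open MeasureTheory Set Metric
open scoped ContDiff ENNReal

noncomputable section

namespace WeightedEnergy

open Filter
open scoped Topology RealInnerProductSpace

variable {n : ℕ}

/-! The radial map is unstable under translation-like variations. Let `f(r) = ε(1-r)²` and let
`u_{i,ε}` be the projection of `x + r f(r) e_i` to the sphere; it keeps the boundary values, and `ε
= 0` gives `x/‖x‖`. With `s = x_i/r` and `D = 1 + 2fs + f²`, its energy density is `((n-1)/D -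
f²(1-s²)/D²)/r² + f'²(1-s²)/D²` (`sum_norm_sq_partialDeriv_competitor`). Adding the densities for
`ε` and `-ε` cancels the odd orders in `ε`, and adding over `i` replaces `s²` by its mean `1/n`. To
second order what remains is `2(n-1)` times the radial function `n/r² + f'² - (n-3)f²/r²`.

The sign of the second variation is thus that of `∫ r^β (f'² - (n-3) f²/r²) dr` with `β = n+1-p`, a
Hardy-type form. For `f` proportional to `(1-r)²` the quotient of the two integrals is `β(β-1)/3`,
which tends to `2` as `β → 3`, that is as `p → n-2`, whereas `n-3 ≥ 3`. (The profile `1-r` gives the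
limit `3`, which leaves no margin for `n = 6`.)

That margin absorbs the higher orders at the fixed size `ε = 1/100`
(`sum_energyDensity_competitor_le`, `integral_variationPolynomial_neg`), so one of the `2n` maps
`u_{i,±ε}` has less energy than the radial map. Their admissibility is `competitor_spec`. -/

/-! ### Energy density of maps projected to the sphere. -/

lemma hasFDerivAt_norm_of_ne_zero {F : Type*} [NormedAddCommGroup F] [InnerProductSpace ℝ F]
    {x : F} (hx : x ≠ 0) : HasFDerivAt (fun y : F => ‖y‖) (‖x‖⁻¹ • innerSL ℝ x) x := by
  have h := (hasStrictFDerivAt_norm_sq x).hasFDerivAt.sqrt (by positivity)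
  simp only [Real.sqrt_sq (norm_nonneg _)] at h
  refine h.congr_fderiv ?_
  ext y
  simp
  ring

lemma hasFDerivAt_inv_norm_smul {G F : Type*} [NormedAddCommGroup G] [NormedSpace ℝ G]
    [NormedAddCommGroup F] [InnerProductSpace ℝ F] {v : G → F} {v' : G →L[ℝ] F} {x : G}
    (hv : HasFDerivAt v v' x) (h0 : v x ≠ 0) (h : G) :
    fderiv ℝ (fun y => ‖v y‖⁻¹ • v y) x h =
      ‖v x‖⁻¹ • v' h - (‖v x‖⁻¹ ^ 3 * ⟪v x, v' h⟫) • v x := by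
  have h1 := (hasFDerivAt_norm_of_ne_zero h0).comp x hv
  have hn : ‖v x‖ ≠ 0 := by simpa using h0
  have h2 := ((hasDerivAt_inv hn).comp_hasFDerivAt x h1).smul hv
  have h3 : HasFDerivAt (fun y => ‖v y‖⁻¹ • v y) _ x := h2
  rw [h3.fderiv]
  simp only [add_apply, smul_apply,
    ContinuousLinearMap.smulRight_apply, ContinuousLinearMap.comp_apply, Function.comp,
    innerSL_apply_apply, smul_eq_mul]
  rw [sub_eq_add_neg, ← neg_smul]
  congr 2
  field_simp

/-- Pythagoras: the derivative of `v/‖v‖` is the component of `v' h` orthogonal to `v`, divided by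
`‖v‖`. -/
lemma norm_sq_fderiv_inv_norm_smul {G F : Type*} [NormedAddCommGroup G] [NormedSpace ℝ G]
    [NormedAddCommGroup F] [InnerProductSpace ℝ F] {v : G → F} {v' : G →L[ℝ] F} {x : G}
    (hv : HasFDerivAt v v' x) (h0 : v x ≠ 0) (h : G) :
    ‖fderiv ℝ (fun y => ‖v y‖⁻¹ • v y) x h‖ ^ 2 =
      ‖v' h‖ ^ 2 / ‖v x‖ ^ 2 - ⟪v x, v' h⟫ ^ 2 / (‖v x‖ ^ 2) ^ 2 := by
  rw [hasFDerivAt_inv_norm_smul hv h0, norm_sub_sq_real]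
  have hn : ‖v x‖ ≠ 0 := by simpa using h0
  simp only [norm_smul, inner_smul_left, inner_smul_right, real_inner_comm (v x) (v' h)]
  simp only [norm_inv, norm_mul, norm_pow, mul_pow, Real.norm_eq_abs, sq_abs]
  simp
  field_simp
  ring


/-- The displacement of the identity by the radial profile `φ` in the direction of the `i`-th
coordinate. -/
def shift (i : Fin n) (φ : ℝ → ℝ) (x : E n) : E n := x + φ ‖x‖ • EuclideanSpace.single i 1

/-- The projection of `shift i φ` to the unit sphere. -/
def shiftedRadialMap (i : Fin n) (φ : ℝ → ℝ) (x : E n) : E n := ‖shift i φ x‖⁻¹ • shift i φ x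

lemma norm_shift_sq (i : Fin n) (φ : ℝ → ℝ) (x : E n) :
    ‖shift i φ x‖ ^ 2 = ‖x‖ ^ 2 + 2 * φ ‖x‖ * x i + φ ‖x‖ ^ 2 := by
  rw [shift, norm_add_sq_real]
  simp [inner_smul_right, norm_smul, EuclideanSpace.inner_single_right]
  ring

lemma sum_norm_sq_partialDeriv_shiftedRadialMap (i : Fin n) {φ : ℝ → ℝ} {φ' : ℝ} {x : E n}
    (hx : x ≠ 0) (hφ : HasDerivAt φ φ' ‖x‖) (h0 : shift i φ x ≠ 0) :
    ∑ j, ‖partialDeriv j (shiftedRadialMap i φ) x‖ ^ 2 =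
      (n + 2 * (φ' / ‖x‖) * x i + φ' ^ 2) / ‖shift i φ x‖ ^ 2 -
      (‖shift i φ x‖ ^ 2 + 2 * (φ' / ‖x‖) * (x i + φ ‖x‖) * (‖x‖ ^ 2 + φ ‖x‖ * x i)
        + φ' ^ 2 * (x i + φ ‖x‖) ^ 2) / (‖shift i φ x‖ ^ 2) ^ 2 := by
  have hr : ‖x‖ ≠ 0 := by simpa using hx
  have hv : HasFDerivAt (shift i φ)
      (ContinuousLinearMap.id ℝ (E n) +
        (φ' • (‖x‖⁻¹ • innerSL ℝ x)).smulRight (EuclideanSpace.single i 1)) x :=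
    (hasFDerivAt_id x).add
      (((hφ.comp_hasFDerivAt x (hasFDerivAt_norm_of_ne_zero hx))).smul_const _)
  -- The derivative of the shift along `e_j` is `e_j + (φ'/r) x_j e_i`; its squared norm and its
  -- inner product with the shift give the two terms.
  have key : ∀ j, ‖partialDeriv j (shiftedRadialMap i φ) x‖ ^ 2 =
      (1 + 2 * (φ' / ‖x‖) * x j * (if j = i then 1 else 0) + (φ' / ‖x‖) ^ 2 * x j ^ 2)
        / ‖shift i φ x‖ ^ 2 -
      (shift i φ x j + (φ' / ‖x‖) * x j * shift i φ x i) ^ 2 / (‖shift i φ x‖ ^ 2) ^ 2 := by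
    intro j
    unfold partialDeriv shiftedRadialMap
    rw [norm_sq_fderiv_inv_norm_smul hv h0]
    have e1 : (ContinuousLinearMap.id ℝ (E n) + (φ' • (‖x‖⁻¹ • innerSL ℝ x)).smulRight
        (EuclideanSpace.single i (1:ℝ))) (EuclideanSpace.single j 1) =
        EuclideanSpace.single j 1 + (φ' / ‖x‖ * x j) • EuclideanSpace.single i (1:ℝ) := by
      simp only [add_apply, ContinuousLinearMap.smulRight_apply, smul_apply,
        ContinuousLinearMap.id_apply, innerSL_apply_apply, EuclideanSpace.inner_single_right,
        smul_eq_mul]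
      congr 2
      simp
      ring
    rw [e1, inner_add_right, inner_smul_right, norm_add_sq_real]
    simp only [inner_smul_right, norm_smul, EuclideanSpace.inner_single_right]
    congr 2
    · simp [mul_pow, eq_comm, sq_abs, -abs_mul, div_pow]
      ring_nf
    · simp
  have hsum : ∑ j, x j ^ 2 = ‖x‖ ^ 2 := by
    rw [EuclideanSpace.norm_sq_eq]; simp
  have hsumv : ∑ j, shift i φ x j ^ 2 = ‖shift i φ x‖ ^ 2 := by
    rw [EuclideanSpace.norm_sq_eq]; simp
  have hi : shift i φ x i = x i + φ ‖x‖ := by simp [shift]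
  have hxv : ∑ j, x j * shift i φ x j = ‖x‖ ^ 2 + φ ‖x‖ * x i := by
    have : ∀ j, x j * shift i φ x j = x j ^ 2 + φ ‖x‖ * x j * (if j = i then 1 else 0) := by
      intro j
      simp [shift]
      split_ifs <;> ring
    simp_rw [this, Finset.sum_add_distrib, hsum]
    simp
  simp_rw [key, Finset.sum_sub_distrib, ← Finset.sum_div, hi]
  congr 2
  · simp_rw [Finset.sum_add_distrib, ← Finset.mul_sum, hsum]
    simp
    field_simp
  · have : ∀ j, (shift i φ x j + (φ' / ‖x‖) * x j * (x i + φ ‖x‖)) ^ 2 =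
        shift i φ x j ^ 2 + 2 * (φ' / ‖x‖) * (x i + φ ‖x‖) * (x j * shift i φ x j)
        + ((φ' / ‖x‖) * (x i + φ ‖x‖)) ^ 2 * x j ^ 2 := by intro j; ring
    simp_rw [this, Finset.sum_add_distrib, ← Finset.mul_sum, hsum, hxv, hsumv]
    field_simp

/-- The energy density of `shiftedRadialMap` in terms of the normalized profile `f = φ / r` and of
the cosine `s` of the angle to the direction of the shift. -/
lemma sum_norm_sq_partialDeriv_shiftedRadialMap_of_profile (i : Fin n) {f : ℝ → ℝ} {f' : ℝ}
    {x : E n} (hx : x ≠ 0) (hf : HasDerivAt f f' ‖x‖) {s D : ℝ} (hs : s = x i / ‖x‖)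
    (hD : D = 1 + 2 * f ‖x‖ * s + f ‖x‖ ^ 2) (hD0 : D ≠ 0) :
    ∑ j, ‖partialDeriv j (shiftedRadialMap i (fun r => r * f r)) x‖ ^ 2 =
      ((n - 1) / D - f ‖x‖ ^ 2 * (1 - s ^ 2) / D ^ 2) / ‖x‖ ^ 2
        + f' ^ 2 * (1 - s ^ 2) / D ^ 2 := by
  have hr : ‖x‖ ≠ 0 := by simpa using hx
  have hxi : x i = ‖x‖ * s := by rw [hs]; field_simp
  have hV : ‖shift i (fun r => r * f r) x‖ ^ 2 = ‖x‖ ^ 2 * D := by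
    rw [norm_shift_sq, hD, hxi]; ring
  have h0 : shift i (fun r => r * f r) x ≠ 0 := by
    intro h
    rw [h] at hV
    simp [hr, hD0] at hV
  have hd : HasDerivAt (fun r => r * f r) (1 * f ‖x‖ + ‖x‖ * f') ‖x‖ := (hasDerivAt_id ‖x‖).mul hf
  rw [sum_norm_sq_partialDeriv_shiftedRadialMap i hx hd h0, hV]
  simp only [hxi]
  generalize ‖x‖ = r at *
  generalize f r = F at *
  field_simp
  rw [hD]
  ring

/-! ### Weak gradients and approximation in `W₀^{1,2}`. -/

lemma tendsto_eLpNorm_two_sub_of_dominated {α F : Type*} [MeasurableSpace α] {μ : Measure α}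
    [NormedAddCommGroup F] {f : ℕ → α → F} {f₀ : α → F} {g : α → ℝ}
    (hf : ∀ k, AEStronglyMeasurable (f k) μ) (hg : MemLp g 2 μ)
    (hb : ∀ k, ∀ᵐ x ∂μ, ‖f k x‖ ≤ g x) (hlim : ∀ᵐ x ∂μ, Tendsto (fun k => f k x) atTop (𝓝 (f₀ x))) :
    Tendsto (fun k => eLpNorm (fun x => f₀ x - f k x) 2 μ) atTop (𝓝 0) := by
  have hf₀ : AEStronglyMeasurable f₀ μ := aestronglyMeasurable_of_tendsto_ae _ hf hlim
  have hb' : ∀ᵐ x ∂μ, ∀ k, ‖f k x‖ ≤ g x := ae_all_iff.2 hb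
  have h1 : Tendsto (fun k => ∫⁻ x, ‖f₀ x - f k x‖ₑ ^ (2 : ℝ) ∂μ) atTop (𝓝 (∫⁻ _, 0 ∂μ)) := by
    refine tendsto_lintegral_of_dominated_convergence' (fun x => ‖2 * g x‖ₑ ^ (2 : ℝ))
      (fun k => (hf₀.sub (hf k)).enorm.pow_const _) (fun k => ?_) ?_ ?_
    · filter_upwards [hb', hlim] with x hx hl
      have h0 : ‖f₀ x‖ ≤ g x := le_of_tendsto hl.norm (Eventually.of_forall hx)
      gcongr
      rw [enorm_le_iff_norm_le]
      calc ‖f₀ x - f k x‖ ≤ ‖f₀ x‖ + ‖f k x‖ := norm_sub_le _ _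
        _ ≤ 2 * g x := by linarith [hx k]
        _ ≤ ‖2 * g x‖ := le_abs_self _
    · have := (hg.const_mul 2).2
      rw [eLpNorm_lt_top_iff_lintegral_rpow_enorm_lt_top (by simp) (by simp)] at this
      simpa using this.ne
    · filter_upwards [hlim] with x hl
      have h2 : Tendsto (fun k => f₀ x - f k x) atTop (𝓝 0) := by
        simpa using (tendsto_const_nhds (x := f₀ x)).sub hl
      have h3 := h2.enorm
      rw [enorm_zero] at h3
      simpa [Function.comp_def] using
        (ENNReal.continuous_rpow_const (y := 2)).continuousAt.tendsto.comp h3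
  have h4 : ∀ k, eLpNorm (fun x => f₀ x - f k x) 2 μ =
      (∫⁻ x, ‖f₀ x - f k x‖ₑ ^ (2 : ℝ) ∂μ) ^ (1 / (2 : ℝ)) := by
    intro k
    rw [eLpNorm_eq_lintegral_rpow_enorm_toReal (by simp) (by simp)]
    simp
  simp_rw [h4]
  rw [lintegral_zero] at h1
  simpa [Function.comp_def] using
    (ENNReal.continuous_rpow_const (y := 1 / (2 : ℝ))).continuousAt.tendsto.comp h1

/-- `r⁻²` is integrable near the origin exactly when `n > 2`. This function dominates all the maps
and gradients approximated below. -/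
lemma memLp_const_div_norm (hn : 3 ≤ n) (C : ℝ) :
    MemLp (fun x : E n => C / ‖x‖) 2 (volume.restrict (unitBall n)) := by
  have hm : Measurable (fun x : E n => C / ‖x‖) := by fun_prop
  rw [memLp_two_iff_integrable_sq hm.aestronglyMeasurable]
  refine integrableOn_ball_of_norm_le_rpow (C := C ^ 2) (α := 2) (by simp; omega) ?_ ?_
    (hm.pow_const 2).aestronglyMeasurable
  · simp
    exact_mod_cast hn
  · refine Eventually.of_forall fun x => le_of_eq ?_
    rw [Real.rpow_neg (norm_nonneg _), Real.norm_of_nonneg (by positivity)]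
    norm_cast
    rw [div_pow]
    rfl

instance isFiniteMeasure_restrict_unitBall :
    IsFiniteMeasure ((volume : Measure (E n)).restrict (unitBall n)) :=
  ⟨by simpa [unitBall] using measure_ball_lt_top⟩

lemma isOpen_unitBall : IsOpen (unitBall n) := isOpen_ball

lemma ae_restrict_unitBall_of_forall (hn : 1 ≤ n) {P : E n → Prop}
    (h : ∀ x ∈ unitBall n, x ≠ 0 → P x) : ∀ᵐ x ∂(volume.restrict (unitBall n)), P x := by
  have : Nonempty (Fin n) := ⟨⟨0, hn⟩⟩
  have h0 : ∀ᵐ x ∂(volume.restrict (unitBall n)), x ≠ (0 : E n) :=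
    ae_restrict_of_ae (Measure.ae_ne volume 0)
  filter_upwards [ae_restrict_mem (measurableSet_ball : MeasurableSet (ball (0 : E n) 1)), h0]
    with x hx hx0 using h x hx hx0

lemma IsTestFunction.continuous_partialDeriv {F : Type*} [NormedAddCommGroup F] [NormedSpace ℝ F]
    {Ω : Set (E n)} {φ : E n → F} (h : IsTestFunction Ω φ) (j : Fin n) :
    Continuous (partialDeriv j φ) :=
  (h.smooth.continuous_fderiv (by simp)).clm_apply continuous_const

lemma IsTestFunction.hasCompactSupport_partialDeriv {F : Type*} [NormedAddCommGroup F]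
    [NormedSpace ℝ F] {Ω : Set (E n)} {φ : E n → F} (h : IsTestFunction Ω φ) (j : Fin n) :
    HasCompactSupport (partialDeriv j φ) :=
  h.compact.fderiv_apply (𝕜 := ℝ) _

lemma IsTestFunction.tsupport_partialDeriv_subset {F : Type*} [NormedAddCommGroup F]
    [NormedSpace ℝ F] {Ω : Set (E n)} {φ : E n → F} (h : IsTestFunction Ω φ) (j : Fin n) :
    tsupport (partialDeriv j φ) ⊆ Ω :=
  (tsupport_fderiv_apply_subset ℝ _).trans h.support_subset

lemma integrableOn_smul_of_tsupport_subset {F : Type*} [NormedAddCommGroup F] [NormedSpace ℝ F]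
    {Ω : Set (E n)} {φ : E n → ℝ} (hφ : Continuous φ) (hc : HasCompactSupport φ)
    (hs : tsupport φ ⊆ Ω) {g : E n → F} (hg : LocallyIntegrableOn g Ω) :
    IntegrableOn (fun x => φ x • g x) Ω := by
  have h1 : IntegrableOn (fun x => φ x • g x) (tsupport φ) :=
    (hg.integrableOn_compact_subset hs hc).continuousOn_smul hφ.continuousOn hc
  refine ((integrableOn_iff_integrable_of_support_subset ?_).1 h1).integrableOn
  intro x hx
  exact subset_tsupport φ fun h0 => hx (by simp [h0])

lemma IsTestFunction.integral_eq_of_differentiable {Ω : Set (E n)}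
    {φ : E n → ℝ} (hφ : IsTestFunction Ω φ) {g : E n → E n} (hg : ContDiff ℝ 1 g) (j : Fin n) :
    ∫ x in Ω, partialDeriv j φ x • g x = - ∫ x in Ω, φ x • partialDeriv j g x := by
  have hg' : Continuous (partialDeriv j g) :=
    (hg.continuous_fderiv (by simp)).clm_apply continuous_const
  rw [setIntegral_eq_integral_of_forall_compl_eq_zero,
    setIntegral_eq_integral_of_forall_compl_eq_zero]
  · have := integral_smul_fderiv_eq_neg_fderiv_smul_of_integrable (μ := volume)
      (f := φ) (g := g) (v := EuclideanSpace.single j (1 : ℝ))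
      (((hφ.continuous_partialDeriv j).smul hg.continuous).integrable_of_hasCompactSupport
        (hφ.hasCompactSupport_partialDeriv j).smul_right)
      ((hφ.smooth.continuous.smul hg').integrable_of_hasCompactSupport hφ.compact.smul_right)
      ((hφ.smooth.continuous.smul hg.continuous).integrable_of_hasCompactSupport
        hφ.compact.smul_right)
      (fun x _ => (hφ.smooth.differentiable (by simp)) x)
      (fun x _ => (hg.differentiable (by simp)) x)
    unfold partialDeriv
    rw [this, neg_neg]
  · intro x hx
    rw [image_eq_zero_of_notMem_tsupport fun h => hx (hφ.support_subset h), zero_smul]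
  · intro x hx
    rw [image_eq_zero_of_notMem_tsupport fun h => hx (hφ.tsupport_partialDeriv_subset j h),
      zero_smul]

lemma isWeakGradient_of_contDiff (Ω : Set (E n)) {g : E n → E n} (hg : ContDiff ℝ 1 g) :
    IsWeakGradient Ω g (fun j => partialDeriv j g) := by
  have hc : ∀ j, Continuous (partialDeriv j g) := fun j =>
    (hg.continuous_fderiv (by simp)).clm_apply continuous_const
  exact ⟨hg.continuous.locallyIntegrable.locallyIntegrableOn _,
    fun j => (hc j).locallyIntegrable.locallyIntegrableOn _,
    fun j φ hφ => hφ.integral_eq_of_differentiable hg j⟩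

lemma IsWeakGradient.add {Ω : Set (E n)} {u v : E n → E n}
    {G H : Fin n → E n → E n} (hu : IsWeakGradient Ω u G) (hv : IsWeakGradient Ω v H) :
    IsWeakGradient Ω (fun x => u x + v x) (fun j x => G j x + H j x) := by
  refine ⟨hu.locallyIntegrable.add hv.locallyIntegrable, fun j =>
    (hu.locallyIntegrable_grad j).add (hv.locallyIntegrable_grad j), fun j φ hφ => ?_⟩
  have hd : ∀ g : E n → E n, LocallyIntegrableOn g Ω →
      IntegrableOn (fun x => partialDeriv j φ x • g x) Ω := fun g hg =>
    integrableOn_smul_of_tsupport_subset (hφ.continuous_partialDeriv j)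
      (hφ.hasCompactSupport_partialDeriv j) (hφ.tsupport_partialDeriv_subset j) hg
  have hi : ∀ g : E n → E n, LocallyIntegrableOn g Ω →
      IntegrableOn (fun x => φ x • g x) Ω := fun g hg =>
    integrableOn_smul_of_tsupport_subset hφ.smooth.continuous hφ.compact hφ.support_subset hg
  simp only [smul_add]
  rw [integral_add (hd u hu.locallyIntegrable) (hd v hv.locallyIntegrable),
    integral_add (hi _ (hu.locallyIntegrable_grad j)) (hi _ (hv.locallyIntegrable_grad j)),
    hu.integral_eq j φ hφ, hv.integral_eq j φ hφ, neg_add]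

/-- Uniqueness turns the chosen `weakGradient` into any explicitly known one, so that energies can
be computed. -/
lemma IsWeakGradient.weakGradient_ae_eq {Ω : Set (E n)} (hΩ : IsOpen Ω) {u : E n → E n}
    {G : Fin n → E n → E n} (h : IsWeakGradient Ω u G) (j : Fin n) :
    ∀ᵐ x ∂(volume.restrict Ω), weakGradient Ω u j x = G j x := by
  have hex : ∃ G, IsWeakGradient Ω u G := ⟨G, h⟩
  rw [weakGradient, dif_pos hex]
  exact IsWeakGradient.ae_eq hΩ hex.choose_spec h j

/-- A map that is approximated, locally uniformly away from the origin and together with its first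
derivatives, by test functions obeying a bound of order `‖x‖⁻¹` belongs to `W₀^{1,2}`. -/
lemma memW12Zero_of_approx (hn : 3 ≤ n) {w : E n → E n} {C : ℝ} {φ : ℕ → E n → E n}
    (hφ : ∀ k, IsTestFunction (unitBall n) (φ k))
    (hb : ∀ k, ∀ x ∈ unitBall n, x ≠ 0 → ‖φ k x‖ ≤ C / ‖x‖)
    (hd : ∀ k, ∀ x ∈ unitBall n, x ≠ 0 → ∀ j, ‖partialDeriv j (φ k) x‖ ≤ C / ‖x‖)
    (hlim : ∀ x ∈ unitBall n, x ≠ 0 → ∀ᶠ k in atTop, φ k =ᶠ[𝓝 x] w) :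
    IsWeakGradient (unitBall n) w (fun j => partialDeriv j w) ∧ MemW12Zero (unitBall n) w := by
  set μ : Measure (E n) := volume.restrict (unitBall n) with hμ
  have hn1 : 1 ≤ n := by omega
  have hg : MemLp (fun x : E n => C / ‖x‖) 2 μ := memLp_const_div_norm hn C
  have hgi : Integrable (fun x : E n => C / ‖x‖) μ := hg.integrable (by norm_num)
  have hmφ : ∀ k, AEStronglyMeasurable (φ k) μ :=
    fun k => (hφ k).smooth.continuous.aestronglyMeasurable
  have hmd : ∀ j k, AEStronglyMeasurable (partialDeriv j (φ k)) μ :=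
    fun j k => ((hφ k).continuous_partialDeriv j).aestronglyMeasurable
  have hbφ : ∀ k, ∀ᵐ x ∂μ, ‖φ k x‖ ≤ C / ‖x‖ :=
    fun k => ae_restrict_unitBall_of_forall hn1 (hb k)
  have hbd : ∀ j k, ∀ᵐ x ∂μ, ‖partialDeriv j (φ k) x‖ ≤ C / ‖x‖ :=
    fun j k => ae_restrict_unitBall_of_forall hn1 fun x hx h0 => hd k x hx h0 j
  have hlφ : ∀ᵐ x ∂μ, Tendsto (fun k => φ k x) atTop (𝓝 (w x)) :=
    ae_restrict_unitBall_of_forall hn1 fun x hx h0 =>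
      tendsto_const_nhds.congr' ((hlim x hx h0).mono fun k hk => hk.eq_of_nhds.symm)
  have hld : ∀ j, ∀ᵐ x ∂μ, Tendsto (fun k => partialDeriv j (φ k) x) atTop
      (𝓝 (partialDeriv j w x)) := fun j =>
    ae_restrict_unitBall_of_forall hn1 fun x hx h0 =>
      tendsto_const_nhds.congr' ((hlim x hx h0).mono fun k hk => by
        simp only [partialDeriv, hk.fderiv_eq])
  have hmem : ∀ {f : ℕ → E n → E n} {f₀ : E n → E n}, (∀ k, AEStronglyMeasurable (f k) μ) →
      (∀ k, ∀ᵐ x ∂μ, ‖f k x‖ ≤ C / ‖x‖) →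
      (∀ᵐ x ∂μ, Tendsto (fun k => f k x) atTop (𝓝 (f₀ x))) → MemLp f₀ 2 μ := by
    intro f f₀ h1 h2 h3
    refine hg.mono' (aestronglyMeasurable_of_tendsto_ae _ h1 h3) ?_
    filter_upwards [ae_all_iff.2 h2, h3] with x hx hl
    exact le_of_tendsto hl.norm (Eventually.of_forall hx)
  have hw := hmem hmφ hbφ hlφ
  have hdw := fun j => hmem (hmd j) (hbd j) (hld j)
  have htest : ∀ {ψ : E n → ℝ} {f : ℕ → E n → E n} {f₀ : E n → E n}, Continuous ψ →
      HasCompactSupport ψ → (∀ k, AEStronglyMeasurable (f k) μ) →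
      (∀ k, ∀ᵐ x ∂μ, ‖f k x‖ ≤ C / ‖x‖) →
      (∀ᵐ x ∂μ, Tendsto (fun k => f k x) atTop (𝓝 (f₀ x))) →
      Tendsto (fun k => ∫ x, ψ x • f k x ∂μ) atTop (𝓝 (∫ x, ψ x • f₀ x ∂μ)) := by
    intro ψ f f₀ hψ hc h1 h2 h3
    obtain ⟨A, hA⟩ := hc.exists_bound_of_continuous hψ
    refine tendsto_integral_of_dominated_convergence (fun x => A * (C / ‖x‖))
      (fun k => hψ.aestronglyMeasurable.smul (h1 k)) (hgi.const_mul A) (fun k => ?_) ?_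
    · filter_upwards [h2 k] with x hx
      rw [norm_smul]
      exact mul_le_mul (hA x) hx (norm_nonneg _) ((norm_nonneg _).trans (hA x))
    · filter_upwards [h3] with x hx using hx.const_smul _
  have hloc : ∀ {f : E n → E n}, MemLp f 2 μ → LocallyIntegrableOn f (unitBall n) := fun hf =>
    IntegrableOn.locallyIntegrableOn (hf.integrable (by norm_num))
  -- Integration by parts holds for each `φ k` and passes to the limit by dominated convergence; the
  -- singularity at the origin contributes nothing.
  have hW : IsWeakGradient (unitBall n) w (fun j => partialDeriv j w) := by
    refine ⟨hloc hw, fun j => hloc (hdw j), fun j ψ hψ => ?_⟩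
    have t1 := htest (hψ.continuous_partialDeriv j) (hψ.hasCompactSupport_partialDeriv j)
      hmφ hbφ hlφ
    have t2 := (htest hψ.smooth.continuous hψ.compact (hmd j) (hbd j) (hld j)).neg
    refine tendsto_nhds_unique t1 (t2.congr fun k => ?_)
    exact (hψ.integral_eq_of_differentiable ((hφ k).smooth.of_le (by simp)) j).symm
  refine ⟨hW, ⟨hw, _, hW, hdw⟩, fun ε hε => ?_⟩
  have e1 := (tendsto_eLpNorm_two_sub_of_dominated hmφ hg hbφ hlφ).eventually_lt_const hε
  have e2 := eventually_all.2 fun j =>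
    (tendsto_eLpNorm_two_sub_of_dominated (hmd j) hg (hbd j) (hld j)).eventually_lt_const hε
  obtain ⟨k, hk1, hk2⟩ := (e1.and e2).exists
  refine ⟨φ k, hφ k, hk1, fun j => lt_of_eq_of_lt (eLpNorm_congr_ae ?_) (hk2 j)⟩
  filter_upwards [hW.weakGradient_ae_eq isOpen_unitBall j] with x hx
  rw [hx]

/-! ### Cut-off near the origin and near the sphere. -/

/-- A smooth step function, equal to `0` for `t ≤ 1` and to `1` for `t ≥ 2`. -/
def smoothStep (t : ℝ) : ℝ := Real.smoothTransition (t - 1)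

lemma contDiff_smoothStep : ContDiff ℝ ∞ smoothStep :=
  Real.smoothTransition.contDiff.comp (contDiff_id.sub contDiff_const)

lemma smoothStep_eq_zero {t : ℝ} (ht : t ≤ 1) : smoothStep t = 0 :=
  Real.smoothTransition.zero_of_nonpos (by linarith)

lemma smoothStep_eq_one {t : ℝ} (ht : 2 ≤ t) : smoothStep t = 1 :=
  Real.smoothTransition.one_of_one_le (by linarith)

/-- The quantity `t g'(t)` is invariant under scaling of `t`, so this bound controls the gradients
of all cut-offs at once, independently of `k`. -/
lemma exists_abs_mul_deriv_smoothStep_le : ∃ M : ℝ, 0 ≤ M ∧ ∀ t, |t * deriv smoothStep t| ≤ M := by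
  have hc : Continuous fun t => t * deriv smoothStep t :=
    continuous_id.mul (contDiff_smoothStep.continuous_deriv (by simp))
  obtain ⟨M, hM⟩ := (isCompact_Icc (a := (0 : ℝ)) (b := 3)).exists_bound_of_continuousOn
    hc.continuousOn
  refine ⟨M, (norm_nonneg _).trans (hM 0 (by simp)), fun t => ?_⟩
  by_cases ht : t ∈ Icc (0 : ℝ) 3
  · exact hM t ht
  · have h0 : deriv smoothStep t = 0 := by
      rw [mem_Icc, not_and_or, not_le, not_le] at ht
      rcases ht with ht | ht
      · have : smoothStep =ᶠ[𝓝 t] fun _ => 0 := by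
          filter_upwards [gt_mem_nhds ht] with s hs using smoothStep_eq_zero (by linarith)
        rw [this.deriv_eq, deriv_const]
      · have : smoothStep =ᶠ[𝓝 t] fun _ => 1 := by
          filter_upwards [lt_mem_nhds ht] with s hs using smoothStep_eq_one (by linarith)
        rw [this.deriv_eq, deriv_const]
    rw [h0, mul_zero, abs_zero]
    exact (norm_nonneg _).trans (hM 0 (by simp))

/-- A function positive exactly on the punctured unit ball. -/
def puncturedBallFun (x : E n) : ℝ := ‖x‖ ^ 2 * (1 - ‖x‖ ^ 2)

lemma contDiff_puncturedBallFun : ContDiff ℝ ∞ (puncturedBallFun (n := n)) :=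
  (contDiff_norm_sq ℝ).mul (contDiff_const.sub (contDiff_norm_sq ℝ))

lemma partialDeriv_puncturedBallFun (j : Fin n) (x : E n) :
    partialDeriv j puncturedBallFun x = 2 * (1 - 2 * ‖x‖ ^ 2) * x j := by
  have h1 := (hasStrictFDerivAt_norm_sq x).hasFDerivAt
  have h2 : HasFDerivAt puncturedBallFun _ x := h1.mul (h1.const_sub 1)
  rw [partialDeriv, h2.fderiv]
  simp [EuclideanSpace.inner_single_right]
  ring

/-- The cut-off functions which vanish near the origin and near the unit sphere. -/
def puncturedBallCutoff (k : ℕ) (x : E n) : ℝ := smoothStep (k * puncturedBallFun x)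

lemma puncturedBallCutoff_nonneg (k : ℕ) (x : E n) : 0 ≤ puncturedBallCutoff k x :=
  Real.smoothTransition.nonneg _

lemma puncturedBallCutoff_le_one (k : ℕ) (x : E n) : puncturedBallCutoff k x ≤ 1 :=
  Real.smoothTransition.le_one _

lemma contDiff_puncturedBallCutoff (k : ℕ) : ContDiff ℝ ∞ (puncturedBallCutoff (n := n) k) :=
  contDiff_smoothStep.comp (contDiff_const.mul contDiff_puncturedBallFun)

lemma partialDeriv_puncturedBallCutoff (k : ℕ) (j : Fin n) (x : E n) :
    partialDeriv j (puncturedBallCutoff k) x =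
      deriv smoothStep (k * puncturedBallFun x) * (k * partialDeriv j puncturedBallFun x) := by
  have h1 : HasFDerivAt (fun y : E n => k * puncturedBallFun y) _ x :=
    ((contDiff_puncturedBallFun.differentiable (by simp)) x).hasFDerivAt.const_mul (k : ℝ)
  have h2 : HasFDerivAt (puncturedBallCutoff k) _ x :=
    ((contDiff_smoothStep.differentiable (by simp)) _).hasDerivAt.comp_hasFDerivAt x h1
  rw [partialDeriv, h2.fderiv]
  simp [partialDeriv]

lemma tsupport_puncturedBallCutoff_subset (k : ℕ) :
    tsupport (puncturedBallCutoff (n := n) k) ⊆ {x | 1 ≤ k * puncturedBallFun x} := by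
  refine closure_minimal (fun x hx => ?_) (isClosed_le continuous_const
    (continuous_const.mul contDiff_puncturedBallFun.continuous))
  by_contra h
  exact hx (smoothStep_eq_zero (not_le.1 h).le)

lemma mem_puncturedBall_of_one_le {k : ℕ} {x : E n} (h : 1 ≤ k * puncturedBallFun x) :
    x ∈ unitBall n ∧ x ≠ 0 := by
  have hp : 0 < puncturedBallFun x := by
    by_contra h0
    have := mul_nonpos_of_nonneg_of_nonpos k.cast_nonneg (not_lt.1 h0)
    linarith
  unfold puncturedBallFun at hp
  constructor
  · rw [unitBall, mem_ball_zero_iff]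
    by_contra h1
    have : 0 ≤ ‖x‖ ^ 2 * (‖x‖ ^ 2 - 1) := by
      have : (1 : ℝ) ≤ ‖x‖ := not_lt.1 h1
      exact mul_nonneg (by positivity) (by nlinarith)
    linarith
  · rintro rfl
    simp at hp

lemma puncturedBallFun_ge {x : E n} (hx : x ∈ unitBall n) :
    ‖x‖ ^ 2 * (1 - ‖x‖) ≤ puncturedBallFun x := by
  rw [unitBall, mem_ball_zero_iff] at hx
  unfold puncturedBallFun
  gcongr
  nlinarith [norm_nonneg x]

lemma abs_partialDeriv_puncturedBallFun_le {x : E n} (hx : x ∈ unitBall n) (j : Fin n) :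
    |partialDeriv j puncturedBallFun x| ≤ 2 * ‖x‖ := by
  rw [unitBall, mem_ball_zero_iff] at hx
  rw [partialDeriv_puncturedBallFun, abs_mul, abs_mul, abs_two]
  have h1 : |1 - 2 * ‖x‖ ^ 2| ≤ 1 := by
    rw [abs_le]; constructor <;> nlinarith [norm_nonneg x]
  have h2 : |x j| ≤ ‖x‖ := PiLp.norm_apply_le x j
  calc 2 * |1 - 2 * ‖x‖ ^ 2| * |x j| ≤ 2 * 1 * ‖x‖ := by gcongr
    _ = 2 * ‖x‖ := by ring

/-- A map which is smooth in the punctured unit ball, vanishes linearly at the unit sphere and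
has a gradient of order `‖x‖⁻¹` belongs to `W₀^{1,2}`. -/
lemma memW12Zero_of_puncturedBall (hn : 3 ≤ n) {w : E n → E n} {C : ℝ} (hC : 0 ≤ C)
    (hs : ∀ x ∈ unitBall n, x ≠ 0 → ContDiffAt ℝ ∞ w x)
    (hb : ∀ x ∈ unitBall n, x ≠ 0 → ‖w x‖ ≤ C * (1 - ‖x‖))
    (hd : ∀ x ∈ unitBall n, x ≠ 0 → ∀ j, ‖partialDeriv j w x‖ ≤ C / ‖x‖) :
    IsWeakGradient (unitBall n) w (fun j => partialDeriv j w) ∧ MemW12Zero (unitBall n) w := by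
  obtain ⟨M, hM0, hM⟩ := exists_abs_mul_deriv_smoothStep_le
  have hC' : C ≤ (2 * M + 1) * C := by nlinarith [mul_nonneg hM0 hC]
  refine memW12Zero_of_approx hn (C := (2 * M + 1) * C)
    (φ := fun k x => puncturedBallCutoff k x • w x) ?_ ?_ ?_ ?_
  · intro k
    have hsub : tsupport (fun x => puncturedBallCutoff k x • w x) ⊆
        {x | 1 ≤ k * puncturedBallFun x} :=
      (tsupport_smul_subset_left _ _).trans (tsupport_puncturedBallCutoff_subset k)
    refine ⟨?_, ?_, fun x hx => (mem_puncturedBall_of_one_le (hsub hx)).1⟩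
    · rw [contDiff_iff_contDiffAt]
      intro x
      by_cases hx : x ∈ tsupport (puncturedBallCutoff (n := n) k)
      · obtain ⟨h1, h2⟩ := mem_puncturedBall_of_one_le (tsupport_puncturedBallCutoff_subset k hx)
        exact (contDiff_puncturedBallCutoff k).contDiffAt.smul (hs x h1 h2)
      · refine (contDiffAt_const (c := (0 : E n))).congr_of_eventuallyEq ?_
        filter_upwards [(isClosed_tsupport _).isOpen_compl.mem_nhds hx] with y hy
        rw [image_eq_zero_of_notMem_tsupport hy, zero_smul]
    · refine HasCompactSupport.of_support_subset_isCompact (isCompact_closedBall (0 : E n) 1) ?_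
      exact fun x hx => ball_subset_closedBall
        (mem_puncturedBall_of_one_le (hsub (subset_tsupport _ hx))).1
  · intro k x hx h0
    have hr : 0 < ‖x‖ := norm_pos_iff.2 h0
    have hr1 : ‖x‖ < 1 := mem_ball_zero_iff.1 hx
    rw [norm_smul, le_div_iff₀ hr, Real.norm_of_nonneg (puncturedBallCutoff_nonneg k x)]
    calc puncturedBallCutoff k x * ‖w x‖ * ‖x‖ ≤ 1 * (C * (1 - ‖x‖)) * 1 := by
          gcongr
          · exact puncturedBallCutoff_le_one k x
          · exact hb x hx h0
      _ ≤ (2 * M + 1) * C := by nlinarith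
  · intro k x hx h0 j
    have hr : 0 < ‖x‖ := norm_pos_iff.2 h0
    have hr1 : ‖x‖ < 1 := mem_ball_zero_iff.1 hx
    have hp : 0 < ‖x‖ ^ 2 * (1 - ‖x‖) := by
      have : 0 < 1 - ‖x‖ := by linarith
      positivity
    have hp' := hp.trans_le (puncturedBallFun_ge hx)
    have e : partialDeriv j (fun x => puncturedBallCutoff k x • w x) x =
        puncturedBallCutoff k x • partialDeriv j w x +
          partialDeriv j (puncturedBallCutoff k) x • w x := by
      have h1 := ((contDiff_puncturedBallCutoff k).differentiable (by simp) x).hasFDerivAt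
      have h2 := ((hs x hx h0).differentiableAt (by simp)).hasFDerivAt
      have h3 : HasFDerivAt (fun x => puncturedBallCutoff k x • w x) _ x := h1.smul h2
      rw [partialDeriv, h3.fderiv]
      simp [partialDeriv]
    have b1 : ‖puncturedBallCutoff k x • partialDeriv j w x‖ ≤ C / ‖x‖ := by
      rw [norm_smul, Real.norm_of_nonneg (puncturedBallCutoff_nonneg k x)]
      calc puncturedBallCutoff k x * ‖partialDeriv j w x‖ ≤ 1 * (C / ‖x‖) := by
            gcongr
            · exact puncturedBallCutoff_le_one k x
            · exact hd x hx h0 j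
        _ = C / ‖x‖ := one_mul _
    have b2 : ‖partialDeriv j (puncturedBallCutoff k) x • w x‖ ≤ 2 * M * C / ‖x‖ := by
      -- With `t = kρ` the factor `k g'(t)` becomes `t g'(t)/ρ`, which removes `k`. Then `|∂ρ|/ρ ≤
      -- 2r/(r²(1-r))`, and the factor `1-r` in the bound of `w` cancels the singularity at the
      -- sphere.
      have e2 : partialDeriv j (puncturedBallCutoff k) x =
          (k * puncturedBallFun x * deriv smoothStep (k * puncturedBallFun x)) *
            (partialDeriv j puncturedBallFun x / puncturedBallFun x) := by
        rw [partialDeriv_puncturedBallCutoff]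
        field_simp
      rw [norm_smul, e2, norm_mul, norm_div, Real.norm_eq_abs, Real.norm_eq_abs,
        Real.norm_of_nonneg hp'.le]
      calc _ ≤ M * (2 * ‖x‖ / (‖x‖ ^ 2 * (1 - ‖x‖))) * (C * (1 - ‖x‖)) := by
            gcongr
            · exact hM _
            · exact abs_partialDeriv_puncturedBallFun_le hx j
            · exact puncturedBallFun_ge hx
            · exact hb x hx h0
        _ = 2 * M * C / ‖x‖ := by
            have : 1 - ‖x‖ ≠ 0 := by linarith
            field_simp
    rw [e]
    calc _ ≤ C / ‖x‖ + 2 * M * C / ‖x‖ := (norm_add_le _ _).trans (add_le_add b1 b2)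
      _ = (2 * M + 1) * C / ‖x‖ := by ring
  · intro x hx h0
    have hr : 0 < ‖x‖ := norm_pos_iff.2 h0
    have hr1 : ‖x‖ < 1 := mem_ball_zero_iff.1 hx
    have hp' : 0 < puncturedBallFun x :=
      (mul_pos (by positivity) (by linarith)).trans_le (puncturedBallFun_ge hx)
    have ht : Tendsto (fun k : ℕ => (k : ℝ) * puncturedBallFun x) atTop atTop :=
      tendsto_natCast_atTop_atTop.atTop_mul_const hp'
    filter_upwards [ht.eventually_gt_atTop 2] with k hk
    have hcont : Continuous fun y : E n => (k : ℝ) * puncturedBallFun y :=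
      continuous_const.mul contDiff_puncturedBallFun.continuous
    filter_upwards [hcont.continuousAt.eventually (lt_mem_nhds hk)] with y hy
    rw [puncturedBallCutoff, smoothStep_eq_one hy.le, one_smul]

lemma partialDeriv_sub_id {u : E n → E n} {x : E n} (hu : DifferentiableAt ℝ u x) (j : Fin n) :
    partialDeriv j (fun y => u y - y) x = partialDeriv j u x - EuclideanSpace.single j 1 := by
  have h : HasFDerivAt (fun y => u y - y) (fderiv ℝ u x - ContinuousLinearMap.id ℝ (E n)) x :=
    hu.hasFDerivAt.sub (hasFDerivAt_id x)
  rw [partialDeriv, h.fderiv]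
  rfl

lemma partialDeriv_id (j : Fin n) (x : E n) :
    partialDeriv j (fun y : E n => y) x = EuclideanSpace.single j 1 := by
  simp [partialDeriv]

/-- A sphere-valued map which is smooth in the punctured unit ball, has a gradient of order
`‖x‖⁻¹` and differs from the identity by `O(1 - ‖x‖)` is admissible, and its weak gradient is its
classical gradient. -/
lemma mem_admissibleMaps_of_puncturedBall (hn : 3 ≤ n) {u : E n → E n} {C : ℝ} (hC : 0 ≤ C)
    (hs : ∀ x ∈ unitBall n, x ≠ 0 → ContDiffAt ℝ ∞ u x)
    (h1 : ∀ x ∈ unitBall n, x ≠ 0 → ‖u x‖ = 1)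
    (hb : ∀ x ∈ unitBall n, x ≠ 0 → ‖u x - x‖ ≤ C * (1 - ‖x‖))
    (hd : ∀ x ∈ unitBall n, x ≠ 0 → ∀ j, ‖partialDeriv j u x‖ ≤ C / ‖x‖) :
    u ∈ admissibleMaps n ∧ ∀ α : ℝ, weightedEnergy n α u =
      ∫⁻ x in unitBall n, ENNReal.ofReal (‖x‖ ^ α * ∑ j, ‖partialDeriv j u x‖ ^ 2) := by
  have hn1 : 1 ≤ n := by omega
  have hdiff : ∀ x ∈ unitBall n, x ≠ 0 → DifferentiableAt ℝ u x := fun x hx h0 =>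
    (hs x hx h0).differentiableAt (by simp)
  obtain ⟨hW, hW0⟩ := memW12Zero_of_puncturedBall (w := fun x => u x - x) (C := C + 1) hn
    (by linarith) (fun x hx h0 => (hs x hx h0).sub contDiffAt_id)
    (fun x hx h0 => (hb x hx h0).trans (by
      have : ‖x‖ < 1 := mem_ball_zero_iff.1 hx
      nlinarith))
    (fun x hx h0 j => by
      have hr : 0 < ‖x‖ := norm_pos_iff.2 h0
      have hr1 : ‖x‖ < 1 := mem_ball_zero_iff.1 hx
      rw [partialDeriv_sub_id (hdiff x hx h0), add_div]
      refine (norm_sub_le _ _).trans (add_le_add (hd x hx h0 j) ?_)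
      rw [PiLp.norm_single, norm_one, le_div_iff₀ hr]
      linarith)
  have hid : ContDiff ℝ 1 (fun x : E n => x) := contDiff_id
  have hU := hW.add (isWeakGradient_of_contDiff (unitBall n) hid)
  simp only [sub_add_cancel, partialDeriv_id] at hU
  have hgrad : ∀ j, ∀ᵐ x ∂(volume.restrict (unitBall n)),
      partialDeriv j (fun x => u x - x) x + EuclideanSpace.single j 1 = partialDeriv j u x :=
    fun j => ae_restrict_unitBall_of_forall hn1 fun x hx h0 => by
      rw [partialDeriv_sub_id (hdiff x hx h0), sub_add_cancel]
  refine ⟨⟨⟨?_, _, hU, fun j => ?_⟩, ae_restrict_unitBall_of_forall hn1 h1, hW0⟩, fun α => ?_⟩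
  · have hx : MemLp (fun x : E n => x) 2 (volume.restrict (unitBall n)) :=
      MemLp.of_bound continuous_id.aestronglyMeasurable 1
        (ae_restrict_unitBall_of_forall hn1 fun x hx _ => (mem_ball_zero_iff.1 hx).le)
    have := hW0.1.1.add hx
    refine this.ae_eq (Eventually.of_forall fun x => ?_)
    simp
  · obtain ⟨G, hG, hG2⟩ := hW0.1.2
    have e : G j =ᵐ[volume.restrict (unitBall n)] partialDeriv j (fun x => u x - x) :=
      IsWeakGradient.ae_eq isOpen_unitBall hG hW j
    exact ((memLp_congr_ae e).1 (hG2 j)).add (memLp_const _)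
  · refine lintegral_congr_ae ?_
    filter_upwards [ae_all_iff.2 fun j => hU.weakGradient_ae_eq isOpen_unitBall j,
      ae_all_iff.2 hgrad] with x hx hg
    simp only [hx, hg]

/-! ### The competitors and their admissibility. -/

/-- The projection to the unit sphere of the displacement of the identity by
`ε r (1 - r)²` in the direction of the `i`-th coordinate. -/
def competitor (i : Fin n) (ε : ℝ) : E n → E n :=
  shiftedRadialMap i fun r => r * (ε * (1 - r) ^ 2)

lemma competitor_zero (i : Fin n) : competitor i 0 = radialMap n := by
  ext1 x
  simp [competitor, shiftedRadialMap, shift, radialMap]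

lemma abs_div_norm_le_one (i : Fin n) (x : E n) : |x i / ‖x‖| ≤ 1 := by
  rw [abs_div, abs_norm]
  exact div_le_one_of_le₀ (PiLp.norm_apply_le x i) (norm_nonneg _)

/-- The right-hand side is the squared length of a unit vector plus a vector of length `|f|` at
angle of cosine `s`. The bound keeps the denominators `D` away from `0`. -/
lemma sq_one_sub_abs_le {f s : ℝ} (hs : |s| ≤ 1) : (1 - |f|) ^ 2 ≤ 1 + 2 * f * s + f ^ 2 := by
  have h : |f * s| ≤ |f| := by
    rw [abs_mul]; exact mul_le_of_le_one_right (abs_nonneg f) hs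
  nlinarith [neg_abs_le (f * s), sq_abs f]

lemma abs_profile_le {ε r : ℝ} (hr0 : 0 ≤ r) (hr1 : r ≤ 1) : |ε * (1 - r) ^ 2| ≤ |ε| := by
  rw [abs_mul, abs_of_nonneg (sq_nonneg (1 - r))]
  exact mul_le_of_le_one_right (abs_nonneg ε) (by nlinarith)

lemma norm_inv_norm_smul_sub_le {F : Type*} [NormedAddCommGroup F] [NormedSpace ℝ F] {v x : F}
    (hv : v ≠ 0) (hx : x ≠ 0) : ‖‖v‖⁻¹ • v - ‖x‖⁻¹ • x‖ ≤ 2 * (‖v - x‖ / ‖x‖) := by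
  have hv' : 0 < ‖v‖ := norm_pos_iff.2 hv
  have hx' : 0 < ‖x‖ := norm_pos_iff.2 hx
  have e : ‖v‖⁻¹ • v - ‖x‖⁻¹ • x = ‖x‖⁻¹ • (v - x) + (‖v‖⁻¹ - ‖x‖⁻¹) • v := by
    rw [smul_sub, sub_smul]; abel
  rw [e]
  refine (norm_add_le _ _).trans ?_
  have h2 : ‖(‖v‖⁻¹ - ‖x‖⁻¹) • v‖ = |‖x‖ - ‖v‖| / ‖x‖ := by
    rw [norm_smul, inv_sub_inv hv'.ne' hx'.ne', Real.norm_eq_abs, abs_div, abs_mul, abs_norm,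
      abs_norm]
    field_simp
  have h3 : |‖x‖ - ‖v‖| ≤ ‖v - x‖ := by
    rw [norm_sub_rev]; exact abs_norm_sub_norm_le x v
  rw [h2, norm_smul, norm_inv, norm_norm, two_mul, ← div_eq_inv_mul]
  gcongr

lemma sum_norm_sq_partialDeriv_competitor (i : Fin n) {ε : ℝ} (hε : |ε| ≤ 1 / 100) {x : E n}
    (hx : x ∈ unitBall n) (h0 : x ≠ 0) {f s D : ℝ} (hs : s = x i / ‖x‖)
    (hf : f = ε * (1 - ‖x‖) ^ 2) (hD : D = 1 + 2 * f * s + f ^ 2) :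
    ∑ j, ‖partialDeriv j (competitor i ε) x‖ ^ 2 =
      ((n - 1) / D - f ^ 2 * (1 - s ^ 2) / D ^ 2) / ‖x‖ ^ 2
        + (2 * ε * (1 - ‖x‖)) ^ 2 * (1 - s ^ 2) / D ^ 2 := by
  have hr1 : ‖x‖ < 1 := mem_ball_zero_iff.1 hx
  have hD0 : D ≠ 0 := by
    have h1 := sq_one_sub_abs_le (f := f) (hs ▸ abs_div_norm_le_one i x)
    have h2 : |f| ≤ |ε| := hf ▸ abs_profile_le (norm_nonneg x) hr1.le
    nlinarith
  have hder : HasDerivAt (fun r => ε * (1 - r) ^ 2) (-(2 * ε * (1 - ‖x‖))) ‖x‖ := by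
    have := (((hasDerivAt_id ‖x‖).const_sub 1).pow 2).const_mul ε
    refine this.congr_deriv ?_
    simp
    ring
  rw [competitor, sum_norm_sq_partialDeriv_shiftedRadialMap_of_profile i h0 hder hs
    (by rw [hD, hf]) hD0, neg_sq, ← hf]

lemma shift_ne_zero (i : Fin n) {ε : ℝ} (hε : |ε| ≤ 1 / 100) {x : E n} (hx : x ∈ unitBall n)
    (h0 : x ≠ 0) : shift i (fun r => r * (ε * (1 - r) ^ 2)) x ≠ 0 := by
  have hr : 0 < ‖x‖ := norm_pos_iff.2 h0
  have hr1 : ‖x‖ < 1 := mem_ball_zero_iff.1 hx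
  intro h
  have hV := norm_shift_sq i (fun r => r * (ε * (1 - r) ^ 2)) x
  have h1 := sq_one_sub_abs_le (f := ε * (1 - ‖x‖) ^ 2) (abs_div_norm_le_one i x)
  have h2 : |ε * (1 - ‖x‖) ^ 2| ≤ |ε| := abs_profile_le (norm_nonneg x) hr1.le
  have h3 : 0 < 1 + 2 * (ε * (1 - ‖x‖) ^ 2) * (x i / ‖x‖) + (ε * (1 - ‖x‖) ^ 2) ^ 2 := by
    nlinarith
  have h4 := mul_pos (pow_pos hr 2) h3
  rw [h, norm_zero] at hV
  have h5 : ‖x‖ ^ 2 * (1 + 2 * (ε * (1 - ‖x‖) ^ 2) * (x i / ‖x‖) + (ε * (1 - ‖x‖) ^ 2) ^ 2) =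
      ‖x‖ ^ 2 + 2 * (‖x‖ * (ε * (1 - ‖x‖) ^ 2)) * x i + (‖x‖ * (ε * (1 - ‖x‖) ^ 2)) ^ 2 := by
    field_simp
  rw [h5, ← hV] at h4
  simp at h4

lemma competitor_spec (hn : 3 ≤ n) (i : Fin n) {ε : ℝ} (hε : |ε| ≤ 1 / 100) :
    competitor i ε ∈ admissibleMaps n ∧ ∀ α : ℝ, weightedEnergy n α (competitor i ε) =
      ∫⁻ x in unitBall n,
        ENNReal.ofReal (‖x‖ ^ α * ∑ j, ‖partialDeriv j (competitor i ε) x‖ ^ 2) := by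
  -- One constant for both bounds: the squared gradient turns out to be at most `(2n+1)/r²`, and the
  -- distance to the identity at most `(1 + 1/50)(1-r)`.
  refine mem_admissibleMaps_of_puncturedBall (C := 2 * n + 2) hn (by positivity) ?_ ?_ ?_ ?_
  · intro x hx h0
    have hv := shift_ne_zero i hε hx h0
    have h1 : ContDiffAt ℝ ∞ (fun y : E n => ‖y‖) x := contDiffAt_norm ℝ h0
    have h2 : ContDiffAt ℝ ∞ (shift i (fun r => r * (ε * (1 - r) ^ 2))) x :=
      contDiffAt_id.add ((h1.mul (contDiffAt_const.mul ((contDiffAt_const.sub h1).pow 2))).smul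
        contDiffAt_const)
    exact ((h2.norm ℝ hv).inv (norm_ne_zero_iff.2 hv)).smul h2
  · intro x hx h0
    have hv := shift_ne_zero i hε hx h0
    rw [competitor, shiftedRadialMap, norm_smul, norm_inv, norm_norm,
      inv_mul_cancel₀ (norm_ne_zero_iff.2 hv)]
  · intro x hx h0
    have hv := shift_ne_zero i hε hx h0
    have hr : 0 < ‖x‖ := norm_pos_iff.2 h0
    have hr1 : ‖x‖ < 1 := mem_ball_zero_iff.1 hx
    have h1 := norm_inv_norm_smul_sub_le hv h0
    have h2 : ‖shift i (fun r => r * (ε * (1 - r) ^ 2)) x - x‖ / ‖x‖ = |ε| * (1 - ‖x‖) ^ 2 := by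
      rw [shift, add_sub_cancel_left, norm_smul, PiLp.norm_single, norm_one, mul_one,
        norm_mul, norm_norm, norm_mul, norm_pow, Real.norm_eq_abs, Real.norm_eq_abs, sq_abs]
      field_simp
    have h3 : ‖‖x‖⁻¹ • x - x‖ = 1 - ‖x‖ := by
      have : ‖x‖⁻¹ • x - x = (‖x‖⁻¹ - 1) • x := by rw [sub_smul, one_smul]
      rw [this, norm_smul, Real.norm_of_nonneg, sub_mul, inv_mul_cancel₀ hr.ne', one_mul]
      rw [sub_nonneg]
      exact (one_le_inv₀ hr).2 hr1.le
    rw [h2] at h1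
    have h4 : |ε| * (1 - ‖x‖) ^ 2 ≤ 1 / 100 * (1 - ‖x‖) := by
      gcongr
      nlinarith
    have h5 : ‖competitor i ε x - x‖ ≤
        ‖competitor i ε x - ‖x‖⁻¹ • x‖ + ‖‖x‖⁻¹ • x - x‖ := norm_sub_le_norm_sub_add_norm_sub _ _ _
    have h6 : ‖competitor i ε x - ‖x‖⁻¹ • x‖ ≤ 2 * (|ε| * (1 - ‖x‖) ^ 2) := h1
    have h7 : (0 : ℝ) ≤ n := n.cast_nonneg
    nlinarith [mul_nonneg h7 (sub_nonneg.2 hr1.le)]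
  · intro x hx h0 j
    have hr : 0 < ‖x‖ := norm_pos_iff.2 h0
    have hr1 : ‖x‖ < 1 := mem_ball_zero_iff.1 hx
    have hn' : (3 : ℝ) ≤ n := by exact_mod_cast hn
    have hsum := sum_norm_sq_partialDeriv_competitor i hε hx h0 rfl rfl rfl
    set s := x i / ‖x‖ with hs
    set f := ε * (1 - ‖x‖) ^ 2 with hf
    set D := 1 + 2 * f * s + f ^ 2 with hD
    have hs1 : |s| ≤ 1 := abs_div_norm_le_one i x
    have hs2 : s ^ 2 ≤ 1 := (sq_le_one_iff_abs_le_one s).2 hs1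
    have hDl : 1 / 2 ≤ D := by
      have h1 := sq_one_sub_abs_le (f := f) hs1
      have h2 : |f| ≤ |ε| := abs_profile_le (norm_nonneg x) hr1.le
      nlinarith
    have hfd : (2 * ε * (1 - ‖x‖)) ^ 2 ≤ 1 / 4 := by
      have h1 : |2 * ε * (1 - ‖x‖)| ≤ 2 * (1 / 100) * 1 := by
        rw [abs_mul, abs_mul, abs_two, abs_of_nonneg (sub_nonneg.2 hr1.le)]
        gcongr
        linarith
      rw [← sq_abs]
      nlinarith [abs_nonneg (2 * ε * (1 - ‖x‖))]
    have hA : ((n - 1) / D - f ^ 2 * (1 - s ^ 2) / D ^ 2) / ‖x‖ ^ 2 ≤ 2 * n / ‖x‖ ^ 2 := by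
      gcongr
      have h1 : ((n : ℝ) - 1) / D ≤ 2 * n := by
        rw [div_le_iff₀ (by linarith)]; nlinarith
      have h2 : 0 ≤ f ^ 2 * (1 - s ^ 2) / D ^ 2 :=
        div_nonneg (mul_nonneg (sq_nonneg _) (by linarith)) (sq_nonneg _)
      linarith
    have hB : (2 * ε * (1 - ‖x‖)) ^ 2 * (1 - s ^ 2) / D ^ 2 ≤ 1 / ‖x‖ ^ 2 := by
      have h1 : (2 * ε * (1 - ‖x‖)) ^ 2 * (1 - s ^ 2) / D ^ 2 ≤ 1 := by
        rw [div_le_one (by positivity)]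
        nlinarith [sq_nonneg (2 * ε * (1 - ‖x‖)), sq_nonneg s]
      have h2 : 1 ≤ 1 / ‖x‖ ^ 2 := by
        rw [le_div_iff₀ (by positivity)]; nlinarith
      exact h1.trans h2
    have hj : ‖partialDeriv j (competitor i ε) x‖ ^ 2 ≤ ((2 * n + 2) / ‖x‖) ^ 2 := by
      calc _ ≤ ∑ j, ‖partialDeriv j (competitor i ε) x‖ ^ 2 :=
            Finset.single_le_sum (f := fun j => ‖partialDeriv j (competitor i ε) x‖ ^ 2)
              (fun _ _ => sq_nonneg _) (Finset.mem_univ j)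
        _ ≤ 2 * n / ‖x‖ ^ 2 + 1 / ‖x‖ ^ 2 := hsum ▸ add_le_add hA hB
        _ = (2 * n + 1) / ‖x‖ ^ 2 := by ring
        _ ≤ (2 * n + 2) ^ 2 / ‖x‖ ^ 2 := by gcongr; nlinarith
        _ = ((2 * n + 2) / ‖x‖) ^ 2 := by rw [div_pow]
    exact (sq_le_sq₀ (norm_nonneg _) (by positivity)).1 hj

/-! ### The energy density averaged over signs and directions. -/

/-- With `F = f²` and `S = s²` the sum is `2(1+F)/((1+F)² - 4FS)`, whose expansion is `2(1 - F + 4FS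
+ O(F²))`; the term `8F²` covers the remainder. -/
lemma inv_add_inv_le {f s : ℝ} (hf : |f| ≤ 1 / 100) (hs : |s| ≤ 1) :
    1 / (1 + 2 * f * s + f ^ 2) + 1 / (1 - 2 * f * s + f ^ 2) ≤
      2 * (1 - f ^ 2 + 4 * f ^ 2 * s ^ 2 + 8 * (f ^ 2) ^ 2) := by
  have h1 := sq_one_sub_abs_le (f := f) hs
  have h2 := sq_one_sub_abs_le (f := f) (s := -s) (by rwa [abs_neg])
  have hp : 0 < 1 + 2 * f * s + f ^ 2 := by nlinarith
  have hm : 0 < 1 - 2 * f * s + f ^ 2 := by nlinarith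
  have hs2 : s ^ 2 ≤ 1 := (sq_le_one_iff_abs_le_one s).2 hs
  have hF : f ^ 2 ≤ 1 / 10000 := by rw [← sq_abs]; nlinarith [abs_nonneg f]
  rw [div_add_div _ _ hp.ne' hm.ne', div_le_iff₀ (mul_pos hp hm)]
  have e : (1 + 2 * f * s + f ^ 2) * (1 - 2 * f * s + f ^ 2) =
      (1 + f ^ 2) ^ 2 - 4 * f ^ 2 * s ^ 2 := by ring
  rw [e]
  have hF0 := sq_nonneg f
  have hs0 := sq_nonneg s
  generalize f ^ 2 = F at *
  generalize s ^ 2 = S at *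
  have key : 0 ≤ F ^ 2 * (7 - (4 * S - 2) * (4 * S - 1)) := by
    apply mul_nonneg (sq_nonneg F); nlinarith
  -- After clearing denominators the difference begins at order `F²`. Here part of that order is
  -- reserved to absorb the terms in `F³` and `F⁴`; `key` takes the rest that depends on `S`.
  have k2 : 0 ≤ F ^ 2 * (1 + (15 + (4 - 32) * S) * F + 8 * F ^ 2) := by
    apply mul_nonneg (sq_nonneg F)
    nlinarith [mul_nonneg hF0 hs0, mul_nonneg hF0 (sub_nonneg.2 hs2), sq_nonneg F]
  nlinarith

/-- By convexity `1/D²` lies above its tangent `3 - 2D` at `D = 1`, and the two denominators add up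
to `2 + 2f²`. -/
lemma le_inv_sq_add_inv_sq {f s : ℝ} (hf : |f| ≤ 1 / 100) (hs : |s| ≤ 1) :
    2 * (1 - 2 * f ^ 2) ≤
      1 / (1 + 2 * f * s + f ^ 2) ^ 2 + 1 / (1 - 2 * f * s + f ^ 2) ^ 2 := by
  have h1 := sq_one_sub_abs_le (f := f) hs
  have h2 := sq_one_sub_abs_le (f := f) (s := -s) (by rwa [abs_neg])
  have hp : 0 < 1 + 2 * f * s + f ^ 2 := by nlinarith
  have hm : 0 < 1 - 2 * f * s + f ^ 2 := by nlinarith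
  have tangent : ∀ D : ℝ, 0 < D → 3 - 2 * D ≤ 1 / D ^ 2 := by
    intro D hD
    rw [le_div_iff₀ (by positivity)]
    nlinarith [mul_nonneg (sq_nonneg (D - 1)) (by linarith : 0 ≤ 2 * D + 1)]
  have := tangent _ hp
  have := tangent _ hm
  linarith

/-- Here `D ≥ (99/100)²`, and `21/20` exceeds `(100/99)⁴`. -/
lemma inv_sq_le {f s : ℝ} (hf : |f| ≤ 1 / 100) (hs : |s| ≤ 1) :
    1 / (1 + 2 * f * s + f ^ 2) ^ 2 ≤ 21 / 20 := by
  have h1 := sq_one_sub_abs_le (f := f) hs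
  have hp : 9801 / 10000 ≤ 1 + 2 * f * s + f ^ 2 := by nlinarith
  rw [div_le_iff₀ (by positivity)]
  nlinarith

/-- The radial function which bounds the second variation of the energy. -/
def variationDensity (r : ℝ) : ℝ := 21 / 5 * (1 - r) ^ 2 - 1497 / 500 * (1 - r) ^ 4 / r ^ 2

/-- After the signs are paired, the bound for each direction is affine in `(x_i/r)²`, and these
squares sum to `1`. The total is therefore radial pointwise and no integration over spheres is
needed. -/
lemma sum_energyDensity_competitor_le (hn : 6 ≤ n) {ε : ℝ} (hε : |ε| ≤ 1 / 100) {x : E n}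
    (hx : x ∈ unitBall n) (h0 : x ≠ 0) :
    ∑ i, (∑ j, ‖partialDeriv j (competitor i ε) x‖ ^ 2 +
        ∑ j, ‖partialDeriv j (competitor i (-ε)) x‖ ^ 2) ≤
      2 * (n - 1) * (n / ‖x‖ ^ 2 + ε ^ 2 * variationDensity ‖x‖) := by
  have hr : 0 < ‖x‖ := norm_pos_iff.2 h0
  have hr1 : ‖x‖ < 1 := mem_ball_zero_iff.1 hx
  have hn' : (6 : ℝ) ≤ n := by exact_mod_cast hn
  set f := ε * (1 - ‖x‖) ^ 2 with hf
  have hf1 : |f| ≤ 1 / 100 := (abs_profile_le (norm_nonneg x) hr1.le).trans hε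
  set h := (2 * ε * (1 - ‖x‖)) ^ 2 with hh
  have hh0 : 0 ≤ h := sq_nonneg _
  have hi : ∀ i, ∑ j, ‖partialDeriv j (competitor i ε) x‖ ^ 2 +
        ∑ j, ‖partialDeriv j (competitor i (-ε)) x‖ ^ 2 ≤
      2 * (((n - 1) * (1 - f ^ 2 + 4 * f ^ 2 * (x i / ‖x‖) ^ 2 + 8 * (f ^ 2) ^ 2)
        - f ^ 2 * (1 - (x i / ‖x‖) ^ 2) * (1 - 2 * f ^ 2)) / ‖x‖ ^ 2
        + 21 / 20 * h * (1 - (x i / ‖x‖) ^ 2)) := by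
    intro i
    rw [sum_norm_sq_partialDeriv_competitor i hε hx h0 rfl hf rfl,
      sum_norm_sq_partialDeriv_competitor i (f := -f) (by rwa [abs_neg]) hx h0 rfl
        (by rw [hf]; ring) rfl]
    set s := x i / ‖x‖ with hs
    have hs1 : |s| ≤ 1 := abs_div_norm_le_one i x
    have hs2 : 0 ≤ 1 - s ^ 2 := sub_nonneg.2 ((sq_le_one_iff_abs_le_one s).2 hs1)
    have a1 := inv_add_inv_le hf1 hs1
    have a2 := le_inv_sq_add_inv_sq hf1 hs1
    have a3 := inv_sq_le hf1 hs1
    have a4 := inv_sq_le (f := -f) (by rwa [abs_neg]) hs1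
    have e1 : (1 + 2 * -f * s + (-f) ^ 2) = 1 - 2 * f * s + f ^ 2 := by ring
    rw [e1] at a4 ⊢
    have e2 : (2 * -ε * (1 - ‖x‖)) ^ 2 = h := by rw [hh]; ring
    rw [e2, neg_sq]
    generalize 1 + 2 * f * s + f ^ 2 = P at *
    generalize 1 - 2 * f * s + f ^ 2 = M at *
    calc _ = ((n - 1) * (1 / P + 1 / M) - f ^ 2 * (1 - s ^ 2) * (1 / P ^ 2 + 1 / M ^ 2)) / ‖x‖ ^ 2
          + h * (1 - s ^ 2) * (1 / P ^ 2 + 1 / M ^ 2) := by ring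
      _ ≤ ((n - 1) * (2 * (1 - f ^ 2 + 4 * f ^ 2 * s ^ 2 + 8 * (f ^ 2) ^ 2))
          - f ^ 2 * (1 - s ^ 2) * (2 * (1 - 2 * f ^ 2))) / ‖x‖ ^ 2
          + h * (1 - s ^ 2) * (21 / 20 + 21 / 20) := by
        gcongr
        linarith
      _ = _ := by ring
  have hsum : ∑ i, (x i / ‖x‖) ^ 2 = 1 := by
    simp_rw [div_pow, ← Finset.sum_div]
    rw [EuclideanSpace.norm_sq_eq]
    simp only [Real.norm_eq_abs, sq_abs]
    refine div_self ?_
    have : ∑ i, x i ^ 2 = ‖x‖ ^ 2 := by rw [EuclideanSpace.norm_sq_eq]; simp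
    rw [this]; positivity
  refine (Finset.sum_le_sum fun i _ => hi i).trans ?_
  have e : ∑ i, 2 * (((n - 1) * (1 - f ^ 2 + 4 * f ^ 2 * (x i / ‖x‖) ^ 2 + 8 * (f ^ 2) ^ 2)
        - f ^ 2 * (1 - (x i / ‖x‖) ^ 2) * (1 - 2 * f ^ 2)) / ‖x‖ ^ 2
        + 21 / 20 * h * (1 - (x i / ‖x‖) ^ 2)) =
      2 * (n - 1) * ((n - (n - 3) * f ^ 2 + (8 * n + 2) * (f ^ 2) ^ 2) / ‖x‖ ^ 2
        + 21 / 20 * h) := by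
    have e1 : ∀ i, 2 * (((n - 1) * (1 - f ^ 2 + 4 * f ^ 2 * (x i / ‖x‖) ^ 2 + 8 * (f ^ 2) ^ 2)
        - f ^ 2 * (1 - (x i / ‖x‖) ^ 2) * (1 - 2 * f ^ 2)) / ‖x‖ ^ 2
        + 21 / 20 * h * (1 - (x i / ‖x‖) ^ 2)) =
        2 * (((n - 1) * (1 - f ^ 2 + 8 * (f ^ 2) ^ 2) - f ^ 2 * (1 - 2 * f ^ 2)) / ‖x‖ ^ 2
          + 21 / 20 * h) +
        2 * (((n - 1) * (4 * f ^ 2) + f ^ 2 * (1 - 2 * f ^ 2)) / ‖x‖ ^ 2 - 21 / 20 * h) *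
          (x i / ‖x‖) ^ 2 := fun i => by ring
    simp_rw [e1, Finset.sum_add_distrib, ← Finset.mul_sum, hsum]
    simp
    ring
  rw [e]
  have hF : f ^ 2 ≤ 1 / 10000 := by rw [← sq_abs]; nlinarith [abs_nonneg f]
  -- Since `n ≥ 6` and `f² ≤ 10⁻⁴`, the coefficient `(n-3) - (8n+2)f²` is at least `3 - 50/10000`,
  -- hence above `1497/500`.
  have hb : n - (n - 3) * f ^ 2 + (8 * n + 2) * (f ^ 2) ^ 2 ≤ n - 1497 / 500 * f ^ 2 := by
    nlinarith [mul_nonneg (sq_nonneg f) (sub_nonneg.2 hF), sq_nonneg f,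
      mul_nonneg (mul_nonneg (sq_nonneg f) (sub_nonneg.2 hF)) (sub_nonneg.2 hn'),
      mul_nonneg (sq_nonneg f) (sub_nonneg.2 hn')]
  have hn1 : (0 : ℝ) ≤ 2 * (n - 1) := by linarith
  calc _ ≤ 2 * ((n : ℝ) - 1) * ((n - 1497 / 500 * f ^ 2) / ‖x‖ ^ 2 + 21 / 20 * h) := by gcongr
    _ = _ := by
      rw [variationDensity, hf, hh]
      ring

/-! ### Radial integrals and the sign of the second variation. -/

/-- `g` is the integrand with the Jacobian `r^(n-1)` merged in. Agreement on the open interval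
suffices, so `g` can be a combination of positive powers even where `f` is singular at `0`. -/
lemma integrableOn_unitBall_radial (hn : 1 ≤ n) {f g : ℝ → ℝ}
    (hg : IntervalIntegrable g volume 0 1)
    (hfg : ∀ r ∈ Ioo (0 : ℝ) 1, r ^ (n - 1) * f r = g r) :
    IntegrableOn (fun x : E n => f ‖x‖) (unitBall n) := by
  have : Nonempty (Fin n) := ⟨⟨0, hn⟩⟩
  rw [unitBall, integrableOn_fun_norm_addHaar, finrank_euclideanSpace_fin]
  rw [intervalIntegrable_iff_integrableOn_Ioo_of_le zero_le_one] at hg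
  exact hg.congr_fun (fun r hr => (hfg r hr).symm) measurableSet_Ioo

lemma integral_unitBall_radial (hn : 1 ≤ n) {f g : ℝ → ℝ}
    (hfg : ∀ r ∈ Ioo (0 : ℝ) 1, r ^ (n - 1) * f r = g r) :
    ∫ x in unitBall n, f ‖x‖ =
      n * ((volume : Measure (E n)).real (ball 0 1) * ∫ r in (0 : ℝ)..1, g r) := by
  have : Nonempty (Fin n) := ⟨⟨0, hn⟩⟩
  have e : ∀ x : E n, (unitBall n).indicator (fun x => f ‖x‖) x = (Iio 1).indicator f ‖x‖ := by
    intro x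
    simp [indicator, unitBall]
  have hm : MeasurableSet (unitBall n) := measurableSet_ball
  rw [← integral_indicator hm]
  simp_rw [e]
  rw [integral_fun_norm_addHaar, finrank_euclideanSpace_fin, nsmul_eq_mul, smul_eq_mul,
    intervalIntegral.integral_of_le zero_le_one, integral_Ioc_eq_integral_Ioo]
  congr 2
  rw [← integral_indicator measurableSet_Ioi, ← integral_indicator measurableSet_Ioo]
  congr 1
  ext r
  by_cases h0 : 0 < r <;> by_cases h1 : r < 1 <;> simp [indicator, h0, h1]
  exact hfg r ⟨h0, h1⟩

/-- The radial weight `r ^ β` times `variationDensity`, expanded in powers of `r`. -/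
def variationPolynomial (β r : ℝ) : ℝ :=
  21 / 5 * (r ^ β - 2 * r ^ (β + 1) + r ^ (β + 2)) - 1497 / 500 *
    (r ^ (β - 2) - 4 * r ^ (β - 1) + 6 * r ^ β - 4 * r ^ (β + 1) + r ^ (β + 2))

lemma variationPolynomial_eq {β r : ℝ} (hr : 0 < r) :
    variationPolynomial β r = r ^ β * variationDensity r := by
  have h1 : r ^ (β + 1) = r ^ β * r := by rw [Real.rpow_add hr, Real.rpow_one]
  have h2 : r ^ (β + 2) = r ^ β * r ^ 2 := by rw [Real.rpow_add hr]; norm_cast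
  have h3 : r ^ (β - 2) = r ^ β / r ^ 2 := by rw [Real.rpow_sub hr]; norm_cast
  have h4 : r ^ (β - 1) = r ^ β / r := by rw [Real.rpow_sub hr, Real.rpow_one]
  rw [variationPolynomial, variationDensity, h1, h2, h3, h4]
  field_simp
  ring

lemma intervalIntegrable_variationPolynomial {β : ℝ} (hβ : 3 < β) :
    IntervalIntegrable (variationPolynomial β) volume 0 1 := by
  refine Continuous.intervalIntegrable ?_ _ _
  unfold variationPolynomial
  have hc : ∀ c : ℝ, 0 < c → Continuous fun r : ℝ => r ^ c := fun c hc =>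
    Real.continuous_rpow_const hc.le
  have h1 := hc β (by linarith)
  have h2 := hc (β + 1) (by linarith)
  have h3 := hc (β + 2) (by linarith)
  have h4 := hc (β - 1) (by linarith)
  have h5 := hc (β - 2) (by linarith)
  fun_prop

/-- By Beta integrals, `∫ r^β(1-r)² = 2/((β+1)(β+2)(β+3))` and `∫ r^(β-2)(1-r)⁴ =
24/((β-1)β(β+1)(β+2)(β+3))`. The sign reduces to `(42/5)β(β-1) < 24·1497/500`, which still holds at
`β = 13/4`. -/
lemma integral_variationPolynomial_neg {β : ℝ} (hβ : 3 < β) (hβ' : β < 13 / 4) :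
    ∫ r in (0 : ℝ)..1, variationPolynomial β r < 0 := by
  have hi : ∀ c : ℝ, 0 < c → IntervalIntegrable (fun r : ℝ => r ^ c) volume 0 1 := fun c hc =>
    (Real.continuous_rpow_const hc.le).intervalIntegrable _ _
  have hv : ∀ c : ℝ, 0 < c → ∫ r in (0 : ℝ)..1, r ^ c = 1 / (c + 1) := fun c hc => by
    rw [integral_rpow (Or.inl (by linarith)), Real.one_rpow,
      Real.zero_rpow (by linarith), sub_zero]
  have h1 := hi β (by linarith)
  have h2 := hi (β + 1) (by linarith)
  have h3 := hi (β + 2) (by linarith)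
  have h4 := hi (β - 1) (by linarith)
  have h5 := hi (β - 2) (by linarith)
  have e : ∫ r in (0 : ℝ)..1, variationPolynomial β r =
      21 / 5 * (1 / (β + 1) - 2 * (1 / (β + 1 + 1)) + 1 / (β + 2 + 1)) - 1497 / 500 *
        (1 / (β - 2 + 1) - 4 * (1 / (β - 1 + 1)) + 6 * (1 / (β + 1)) - 4 * (1 / (β + 1 + 1))
          + 1 / (β + 2 + 1)) := by
    unfold variationPolynomial
    have a1 := (h1.sub (h2.const_mul 2)).add h3
    have a2 := ((((h5.sub (h4.const_mul 4)).add (h1.const_mul 6)).sub (h2.const_mul 4)).add h3)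
    rw [intervalIntegral.integral_sub (a1.const_mul _) (a2.const_mul _),
      intervalIntegral.integral_const_mul, intervalIntegral.integral_const_mul,
      intervalIntegral.integral_add (h1.sub (h2.const_mul 2)) h3,
      intervalIntegral.integral_sub h1 (h2.const_mul 2),
      intervalIntegral.integral_add
        (((h5.sub (h4.const_mul 4)).add (h1.const_mul 6)).sub (h2.const_mul 4)) h3,
      intervalIntegral.integral_sub ((h5.sub (h4.const_mul 4)).add (h1.const_mul 6))
        (h2.const_mul 4),
      intervalIntegral.integral_add (h5.sub (h4.const_mul 4)) (h1.const_mul 6),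
      intervalIntegral.integral_sub h5 (h4.const_mul 4)]
    simp only [intervalIntegral.integral_const_mul]
    rw [hv β (by linarith), hv (β + 1) (by linarith), hv (β + 2) (by linarith),
      hv (β - 1) (by linarith), hv (β - 2) (by linarith)]
  have e2 : 21 / 5 * (1 / (β + 1) - 2 * (1 / (β + 1 + 1)) + 1 / (β + 2 + 1)) - 1497 / 500 *
        (1 / (β - 2 + 1) - 4 * (1 / (β - 1 + 1)) + 6 * (1 / (β + 1)) - 4 * (1 / (β + 1 + 1))
          + 1 / (β + 2 + 1)) =
      (42 / 5 * ((β - 1) * β) - 1497 / 500 * 24) /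
        ((β - 1) * β * (β + 1) * (β + 2) * (β + 3)) := by
    have b1 : β - 1 ≠ 0 := by linarith
    have b2 : β ≠ 0 := by linarith
    have b3 : β + 1 ≠ 0 := by linarith
    have b4 : β + 2 ≠ 0 := by linarith
    have b5 : β + 3 ≠ 0 := by linarith
    rw [show β - 2 + 1 = β - 1 by ring, show β - 1 + 1 = β by ring,
      show β + 1 + 1 = β + 2 by ring, show β + 2 + 1 = β + 3 by ring]
    field_simp
    ring
  rw [e, e2]
  refine div_neg_of_neg_of_pos (by nlinarith) ?_
  have : 0 < β - 1 := by linarith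
  positivity

/-! ### Comparison of the energies. -/

/-- Superadditivity of the lower integral is the only direction needed, and it requires no
measurability. -/
lemma sum_lintegral_le_lintegral_sum {ι α : Type*} [MeasurableSpace α] {μ : Measure α}
    (s : Finset ι) (f : ι → α → ℝ≥0∞) :
    ∑ i ∈ s, ∫⁻ x, f i x ∂μ ≤ ∫⁻ x, ∑ i ∈ s, f i x ∂μ := by
  classical
  induction s using Finset.induction_on with
  | empty => simp
  | insert a s ha ih =>
    simp only [Finset.sum_insert ha]
    exact (add_le_add_right ih _).trans (le_lintegral_add _ _)

lemma radialMap_mem_admissibleMaps (hn : 3 ≤ n) : radialMap n ∈ admissibleMaps n :=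
  competitor_zero (⟨0, by omega⟩ : Fin n) ▸ (competitor_spec hn _ (by norm_num)).1

lemma weightedEnergy_radialMap (hn : 3 ≤ n) (α : ℝ) :
    weightedEnergy n α (radialMap n) =
      ∫⁻ x in unitBall n, ENNReal.ofReal (‖x‖ ^ α * ((n - 1) / ‖x‖ ^ 2)) := by
  have hε : |(0 : ℝ)| ≤ 1 / 100 := by norm_num
  rw [← competitor_zero (⟨0, by omega⟩ : Fin n), (competitor_spec hn _ hε).2]
  refine lintegral_congr_ae (ae_restrict_unitBall_of_forall (by omega) fun x hx h0 => ?_)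
  simp only
  rw [sum_norm_sq_partialDeriv_competitor _ hε hx h0 rfl rfl rfl]
  simp

lemma exists_weightedEnergy_competitor_lt (hn : 6 ≤ n) {p : ℝ} (hp : (n : ℝ) - 9 / 4 < p)
    (hp' : p < n - 2) : ∃ (i : Fin n) (ε : ℝ), |ε| ≤ 1 / 100 ∧
      weightedEnergy n (2 - p) (competitor i ε) < weightedEnergy n (2 - p) (radialMap n) := by
  -- If none of the `2n` maps with `ε = ±1/100` did better, their total energy would be at least
  -- `2n` times that of the radial map, against the averaged bound.
  by_contra! hmin
  have hn1 : 1 ≤ n := by omega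
  have : Nonempty (Fin n) := ⟨⟨0, hn1⟩⟩
  have hn' : (6 : ℝ) ≤ n := by exact_mod_cast hn
  have hε : |(1 / 100 : ℝ)| ≤ 1 / 100 := by norm_num [abs_of_pos]
  have hε' : |(-(1 / 100) : ℝ)| ≤ 1 / 100 := by rw [abs_neg]; exact hε
  -- The exponent of `r` from the weight and the Jacobian together; `n - 9/4 < p < n - 2` is the
  -- same as `3 < β < 13/4`.
  set β : ℝ := n + 1 - p with hβ
  have hpow : ∀ r : ℝ, 0 < r → r ^ (n - 1) * r ^ (2 - p) = r ^ β := by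
    intro r hr
    rw [← Real.rpow_natCast, ← Real.rpow_add hr, Nat.cast_sub hn1, hβ]
    congr 1
    push_cast
    ring
  have hfg₀ : ∀ r ∈ Ioo (0 : ℝ) 1,
      r ^ (n - 1) * (r ^ (2 - p) * ((n - 1) / r ^ 2)) = (n - 1) * r ^ (β - 2) := by
    intro r hr
    have e : r ^ (β - 2) = r ^ β / r ^ 2 := by rw [Real.rpow_sub hr.1]; norm_cast
    rw [← mul_assoc, hpow r hr.1, e]
    ring
  have hfg₁ : ∀ r ∈ Ioo (0 : ℝ) 1,
      r ^ (n - 1) * (r ^ (2 - p) * variationDensity r) = variationPolynomial β r := by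
    intro r hr
    rw [← mul_assoc, hpow r hr.1, variationPolynomial_eq hr.1]
  have hi₀ : IntegrableOn (fun x : E n => ‖x‖ ^ (2 - p) * ((n - 1) / ‖x‖ ^ 2)) (unitBall n) :=
    integrableOn_unitBall_radial hn1 (f := fun r => r ^ (2 - p) * ((n - 1) / r ^ 2))
      (((Real.continuous_rpow_const (by rw [hβ]; linarith)).intervalIntegrable _ _).const_mul _)
      hfg₀
  have hi₁ : IntegrableOn (fun x : E n => ‖x‖ ^ (2 - p) * variationDensity ‖x‖) (unitBall n) :=
    integrableOn_unitBall_radial hn1 (f := fun r => r ^ (2 - p) * variationDensity r)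
      (intervalIntegrable_variationPolynomial (by rw [hβ]; linarith)) hfg₁
  have hneg : ∫ x in unitBall n, ‖x‖ ^ (2 - p) * variationDensity ‖x‖ < 0 := by
    rw [integral_unitBall_radial hn1 (f := fun r => r ^ (2 - p) * variationDensity r) hfg₁]
    have hvol : 0 < (volume : Measure (E n)).real (ball 0 1) :=
      ENNReal.toReal_pos (measure_ball_pos _ _ one_pos).ne' measure_ball_lt_top.ne
    exact mul_neg_of_pos_of_neg (by linarith) (mul_neg_of_pos_of_neg hvol
      (integral_variationPolynomial_neg (by rw [hβ]; linarith) (by rw [hβ]; linarith)))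
  set E₀ := fun x : E n => ‖x‖ ^ (2 - p) * (((n : ℝ) - 1) / ‖x‖ ^ 2) with hE₀
  set V := fun x : E n => ‖x‖ ^ (2 - p) * variationDensity ‖x‖ with hV
  set c : ℝ := 2 * (n - 1) * (1 / 100) ^ 2 with hc
  have hc0 : 0 < c := by
    have : (0 : ℝ) < n - 1 := by linarith
    positivity
  have hE₀0 : ∀ x, 0 ≤ E₀ x := fun x =>
    mul_nonneg (by positivity) (div_nonneg (by linarith) (sq_nonneg _))
  have hbound : ∀ x ∈ unitBall n, x ≠ 0 →
      ‖x‖ ^ (2 - p) * ∑ i, (∑ j, ‖partialDeriv j (competitor i (1 / 100)) x‖ ^ 2 +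
        ∑ j, ‖partialDeriv j (competitor i (-(1 / 100))) x‖ ^ 2) ≤ 2 * n * E₀ x + c * V x := by
    intro x hx h0
    calc _ ≤ ‖x‖ ^ (2 - p) *
          (2 * (n - 1) * (n / ‖x‖ ^ 2 + (1 / 100) ^ 2 * variationDensity ‖x‖)) := by
          gcongr
          exact sum_energyDensity_competitor_le hn hε hx h0
      _ = _ := by rw [hE₀, hV, hc]; ring
  have hle : ∑ _i : Fin n, (weightedEnergy n (2 - p) (radialMap n) +
      weightedEnergy n (2 - p) (radialMap n)) ≤
        ∫⁻ x in unitBall n, ENNReal.ofReal (2 * n * E₀ x + c * V x) := by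
    calc _ ≤ ∑ i : Fin n, (weightedEnergy n (2 - p) (competitor i (1 / 100)) +
          weightedEnergy n (2 - p) (competitor i (-(1 / 100)))) :=
          Finset.sum_le_sum fun i _ => add_le_add (hmin i _ hε) (hmin i _ hε')
      _ ≤ ∑ i : Fin n, ∫⁻ x in unitBall n,
          (ENNReal.ofReal (‖x‖ ^ (2 - p) *
              ∑ j, ‖partialDeriv j (competitor i (1 / 100)) x‖ ^ 2) +
            ENNReal.ofReal (‖x‖ ^ (2 - p) *
              ∑ j, ‖partialDeriv j (competitor i (-(1 / 100))) x‖ ^ 2)) := by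
          refine Finset.sum_le_sum fun i _ => ?_
          rw [(competitor_spec (by omega) i hε).2, (competitor_spec (by omega) i hε').2]
          exact le_lintegral_add _ _
      _ ≤ _ := sum_lintegral_le_lintegral_sum _ _
      _ ≤ _ := by
          refine lintegral_mono_ae (ae_restrict_unitBall_of_forall hn1 fun x hx h0 => ?_)
          refine le_trans (le_of_eq ?_) (ENNReal.ofReal_le_ofReal (hbound x hx h0))
          rw [Finset.mul_sum, ENNReal.ofReal_sum_of_nonneg fun i _ => by positivity]
          refine Finset.sum_congr rfl fun i _ => ?_
          rw [mul_add, ENNReal.ofReal_add (by positivity) (by positivity)]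
  have hintE : 0 ≤ ∫ x in unitBall n, E₀ x := integral_nonneg hE₀0
  have hint : IntegrableOn (fun x => 2 * n * E₀ x + c * V x) (unitBall n) :=
    (hi₀.const_mul _).add (hi₁.const_mul _)
  rw [weightedEnergy_radialMap (by omega),
    ← ofReal_integral_eq_lintegral_ofReal hi₀ (Filter.Eventually.of_forall hE₀0),
    ← ofReal_integral_eq_lintegral_ofReal hint
      (ae_restrict_unitBall_of_forall hn1 fun x hx h0 =>
        le_trans (by positivity) (hbound x hx h0)),
    integral_add (hi₀.const_mul _) (hi₁.const_mul _), integral_const_mul, integral_const_mul,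
    ← ENNReal.ofReal_add hintE hintE, Finset.sum_const, Finset.card_univ, Fintype.card_fin,
    ← ENNReal.ofReal_nsmul, nsmul_eq_mul] at hle
  have hpos : 0 < ∫ x in unitBall n, E₀ x := by
    rw [hE₀, integral_unitBall_radial hn1 (f := fun r => r ^ (2 - p) * ((n - 1) / r ^ 2)) hfg₀,
      intervalIntegral.integral_const_mul, integral_rpow (Or.inl (by rw [hβ]; linarith)),
      Real.one_rpow, Real.zero_rpow (by rw [hβ]; linarith), sub_zero]
    have hvol : 0 < (volume : Measure (E n)).real (ball 0 1) :=
      ENNReal.toReal_pos (measure_ball_pos _ _ one_pos).ne' measure_ball_lt_top.ne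
    have h1 : (0 : ℝ) < n - 1 := by linarith
    have h2 : 0 < β - 2 + 1 := by rw [hβ]; linarith
    positivity
  -- `ENNReal.ofReal` truncates at `0`, so the inequality of reals comes with the alternative that
  -- the left side is nonpositive; `hpos` excludes it.
  rw [ENNReal.ofReal_le_ofReal_iff'] at hle
  rcases hle with hle | hle
  · nlinarith [mul_pos hc0 (neg_pos.2 hneg)]
  · have : 0 < (n : ℝ) * ∫ x in unitBall n, E₀ x := by positivity
    nlinarith

end WeightedEnergy

end

theorem corollary0p1 (n : ℕ) (hn : 6 ≤ n) :
    ∃ p₀ ∈ Set.Ioo ((n : ℝ) - 3) ((n : ℝ) - 2), ∀ p ∈ Set.Ioo p₀ ((n : ℝ) - 2),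
      WeightedEnergy.radialMap n ∈ WeightedEnergy.admissibleMaps n ∧
      ¬ IsMinOn (WeightedEnergy.weightedEnergy n (2 - p)) (WeightedEnergy.admissibleMaps n)
          (WeightedEnergy.radialMap n) := by
  refine ⟨n - 9 / 4, ⟨by linarith, by linarith⟩, fun p hp =>
    ⟨WeightedEnergy.radialMap_mem_admissibleMaps (by omega), fun hmin => ?_⟩⟩
  obtain ⟨i, ε, hε, hlt⟩ := WeightedEnergy.exists_weightedEnergy_competitor_lt hn hp.1 hp.2
  exact hlt.not_ge (hmin (WeightedEnergy.competitor_spec (by omega) i hε).1)
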